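/- Let $\mathbb T$ be the unit circle, $\overline{\mathbb D}$ the closed unit disk, $\sigma$ normalized Lebesgue measure on $\mathbb T^2$, and let $n,m\ge 0$ be integers. For integers $k,l$ let $\mathcal P_{k,l}=\operatorname{span}_{\mathbb C}\{z^sw^t: 0\le s\le k,\ 0\le t\le l\}\subset\mathbb C[z,w]$ (so $\mathcal P_{k,l}=\{0\}$ if $k<0$ or $l<0$). For a finite positive Borel measure $\mu$ on $\mathbb T^2$ write $\langle f,g\rangle=\int_{\mathbb T^2} f\bar g\,d\mu$, and for subspaces $V,W$ of $\mathbb C[z,w]$ write $V\ominus W=\{f\in V: \langle f,g\rangle=0 \text{ for all } g\in W\}$. Put $$\mathcal E^2_{k,l}=\mathcal P_{k,l}\ominus z\mathcal P_{k-1,l},\qquad \mathcal H_M=\mathcal P_{2n,M}\ominus\operatorname{span}\{z^jw^k: 0\le j\le 2n,\ 0\le k\le M,\ (j,k)\ne(n,0)\}.$$ The measure $\mu$ is called non-degenerate if $\int|f|^2d\mu>0$ for every nonzero $f\in\mathbb C[z,w]$. A polynomial has degree at most $(n,m)$ if its degree in $z$ is at most $n$ and its degree in $w$ is at most $m$. Consider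 the condition (BS) there exists $p\in\mathbb C[z,w]$ of degree at most $(n,m)$ with no zeros on $\mathbb T\times\overline{\mathbb D}$ such that $d\mu=\dfrac{d\sigma}{|p|^2}$. (A) Let $\mu$ be a non-degenerate, finite, positive Borel measure on $\mathbb T^2$. Then (BS) holds if and only if $$\mathcal E^2_{n,M}=\mathcal E^2_{n+j,M}\quad\text{and}\quad \mathcal H_m=\mathcal H_{m+j}\qquad\text{for all integers } M\ge m-1 \text{ and } j\ge 0.$$ (B) Let $\mu$ be a finite, positive Borel measure on $\mathbb T^2$ with moments $c_u=\int z^{-u_1}w^{-u_2}\,d\mu$, $u=(u_1,u_2)\in\mathbb Z^2$. For $N,M\ge0$ let $C^{N,M}=(c_{v-u})_{u,v}$, where $u$ and $v$ range over $\{0,\dots,N\}\times\{0,\dots,M\}$, and, when these matrices are invertible, let $(\gamma^{N,M}_{u,v})=(C^{N,M})^{-1}$ and $(\xi^{M}_{u,v})=(C^{2n,M})^{-1}$. Then (BS) holds if and only if 1. $\det C^{N,M}\neq0$ for all $N,M\ge 0$; 2. $\gamma^{N+1,M}_{(0,j),(N+1,k)}=0$ for all $N\ge n$, all $M\ge \max(m-1,0)$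 and all $j,k=0,\dots,M$; and 3. $\xi^{M}_{(n,0),(j,M)}=0$ for all $M\ge m+1$ and all $j=0,\dots,2n$. -/

import Mathlib

open MeasureTheory

noncomputable section

namespace BernsteinSzego

instance : MeasurableSpace Circle := borel Circle

instance : BorelSpace Circle := ⟨rfl⟩

/-- The torus `𝕋² = 𝕋 × 𝕋`. -/
abbrev Torus : Type := Circle × Circle

/-- The ring `ℂ[z, w]`; the variable `z` has index `0` and the variable `w` has index `1`. -/
abbrev Poly : Type := MvPolynomial (Fin 2) ℂ

/-- The value `p(z, w)`. -/
def evalAt (p : Poly) (z w : ℂ) : ℂ := MvPolynomial.eval ![z, w] p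

/-- The monomial `z ^ s * w ^ t`. -/
def mono (s t : ℕ) : Poly := MvPolynomial.X 0 ^ s * MvPolynomial.X 1 ^ t

/-- Normalized arc length `|dz| / (2π)` on the unit circle. -/
def arcLength : Measure Circle :=
  (ENNReal.ofReal (2 * Real.pi))⁻¹ •
    (volume.restrict (Set.Ioc (-Real.pi) Real.pi)).map Circle.exp

/-- Normalized Lebesgue measure `σ` on `𝕋²`. -/
def sigma : Measure Torus := arcLength.prod arcLength

/-- The measure `dσ / |p|²`. -/
def bernsteinSzego (p : Poly) : Measure Torus :=
  sigma.withDensity fun x => ENNReal.ofReal (1 / ‖evalAt p x.1 x.2‖ ^ 2)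

/-- `∫ |f|² dμ > 0` for every nonzero polynomial `f`. -/
def NonDegenerate (μ : Measure Torus) : Prop :=
  ∀ f : Poly, f ≠ 0 → 0 < ∫ x, ‖evalAt f x.1 x.2‖ ^ 2 ∂μ

/-- The polynomial `p` has degree at most `(n, m)`. -/
def DegreeLE (p : Poly) (n m : ℕ) : Prop :=
  p.degreeOf 0 ≤ n ∧ p.degreeOf 1 ≤ m

/-- The polynomial `p` has no zeros on `𝕋 ×` (closed unit disk). -/
def NoZeros (p : Poly) : Prop :=
  ∀ z w : ℂ, ‖z‖ = 1 → ‖w‖ ≤ 1 → evalAt p z w ≠ 0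

/-- `dμ = dσ / |p|²` for some `p` of degree at most `(n, m)` with no zeros on
`𝕋 ×` (closed unit disk). -/
def IsBernsteinSzego (μ : Measure Torus) (n m : ℕ) : Prop :=
  ∃ p : Poly, DegreeLE p n m ∧ NoZeros p ∧ μ = bernsteinSzego p

/-- The inner product of `L²(μ)` on polynomials. -/
def ip (μ : Measure Torus) (f g : Poly) : ℂ :=
  ∫ x, evalAt f x.1 x.2 * starRingEnd ℂ (evalAt g x.1 x.2) ∂μ

theorem continuous_evalAt (f : Poly) :
    Continuous fun x : Torus => evalAt f (x.1 : ℂ) (x.2 : ℂ) := by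
  unfold evalAt
  have h : Continuous fun x : Torus => (![(x.1 : ℂ), (x.2 : ℂ)] : Fin 2 → ℂ) := by
    refine continuous_pi fun i => ?_
    fin_cases i
    · exact continuous_subtype_val.comp continuous_fst
    · exact continuous_subtype_val.comp continuous_snd
  exact (MvPolynomial.continuous_eval f).comp h

theorem integrable_ip (μ : Measure Torus) [IsFiniteMeasure μ] (f g : Poly) :
    Integrable
      (fun x : Torus => evalAt f x.1 x.2 * starRingEnd ℂ (evalAt g x.1 x.2)) μ :=
  ((continuous_evalAt f).mul
    (Complex.continuous_conj.comp (continuous_evalAt g))).integrable_of_hasCompactSupport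
      (HasCompactSupport.of_compactSpace _)

/-- `V ⊖ W`: the elements of `V` that are orthogonal to `W` in `L²(μ)`. -/
def ominus (μ : Measure Torus) [IsFiniteMeasure μ] (V W : Submodule ℂ Poly) :
    Submodule ℂ Poly where
  carrier := {f | f ∈ V ∧ ∀ g ∈ W, ip μ f g = 0}
  zero_mem' := ⟨V.zero_mem, fun g _ => by simp [ip, evalAt]⟩
  add_mem' := by
    rintro a b ⟨ha, ha'⟩ ⟨hb, hb'⟩
    refine ⟨V.add_mem ha hb, fun g hg => ?_⟩
    have h := integral_add (integrable_ip μ a g) (integrable_ip μ b g)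
    have h1 : ip μ (a + b) g = ip μ a g + ip μ b g := by
      unfold ip
      rw [← h]
      simp [evalAt, add_mul]
    rw [h1, ha' g hg, hb' g hg, add_zero]
  smul_mem' := by
    rintro c a ⟨ha, ha'⟩
    refine ⟨V.smul_mem c ha, fun g hg => ?_⟩
    have h1 : ip μ (c • a) g = c * ip μ a g := by
      unfold ip
      rw [← integral_const_mul]
      simp [evalAt, mul_assoc]
    rw [h1, ha' g hg, mul_zero]

/-- The span of `z ^ s * w ^ t`, `0 ≤ s ≤ k`, `0 ≤ t ≤ l`; it is `{0}` if `k` or `l` is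
negative. -/
def polySpace (k l : ℤ) : Submodule ℂ Poly :=
  Submodule.span ℂ {f | ∃ s t : ℕ, (s : ℤ) ≤ k ∧ (t : ℤ) ≤ l ∧ f = mono s t}

/-- The space `E²_{k,l}`, that is `P_{k,l} ⊖ z P_{k-1,l}`. -/
def spaceE (μ : Measure Torus) [IsFiniteMeasure μ] (k l : ℤ) : Submodule ℂ Poly :=
  ominus μ (polySpace k l)
    ((polySpace (k - 1) l).map (LinearMap.mulLeft ℂ (MvPolynomial.X 0 : Poly)))

/-- The space `H_M`, that is `P_{2n,M}` minus the span of all its monomials except `z ^ n`. -/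
def spaceH (μ : Measure Torus) [IsFiniteMeasure μ] (n M : ℕ) : Submodule ℂ Poly :=
  ominus μ (polySpace (2 * n) M)
    (Submodule.span ℂ
      {f | ∃ s t : ℕ, s ≤ 2 * n ∧ t ≤ M ∧ (s, t) ≠ (n, 0) ∧ f = mono s t})

/-- The moment `c_u = ∫ z ^ (-u₁) w ^ (-u₂) dμ`, `u ∈ ℤ²`. -/
def moment (μ : Measure Torus) (u : ℤ × ℤ) : ℂ :=
  ∫ x, (x.1 : ℂ) ^ (-u.1) * (x.2 : ℂ) ^ (-u.2) ∂μ

/-- The matrix `(c_{v-u})` with `u, v ∈ {0,…,N} × {0,…,M}`. -/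
def momentMatrix (μ : Measure Torus) (N M : ℕ) :
    Matrix (Fin (N + 1) × Fin (M + 1)) (Fin (N + 1) × Fin (M + 1)) ℂ :=
  Matrix.of fun u v =>
    moment μ (((v.1 : ℕ) : ℤ) - ((u.1 : ℕ) : ℤ), ((v.2 : ℕ) : ℤ) - ((u.2 : ℕ) : ℤ))

end BernsteinSzego

end

/-! Write `L μ P s k` for the inner product of `P` with `z^s w^k`. Both directions pass through dual
polynomials: `HasDual μ n M` asks for `d_t ∈ P_{2n,M}`, `t ≤ M`, whose products with all `z^s w^k`,
`s ∈ ℤ`, `0 ≤ k ≤ M`, vanish except for the value 1 at `z^n w^t`. Thus the block Toeplitz operator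
in `z` with blocks of size `M+1` has a banded inverse. For nondegenerate `μ` stability of `E²`
yields such `d_t` (`EStable.hasDual`); conversely they force stability once `L μ P s k → 0` as `s →
∞` (`HasDual.eStable`).

Necessity. Let `dμ = dσ/|p|²`. Quotients `P/p` are analytic in `w` on the closed disk, so Cauchy's
formula evaluates their Fourier coefficients. The polynomial `z^n conj(p(z,0)) p` spans every `H_M`,
`M ≥ m` (`ZeroFree.hStable`), splitting `p` by powers of `w` gives the `d_t` (`ZeroFree.hasDual`),
and the decay is the Riemann–Lebesgue lemma.

Sufficiency. Stability of `H` makes `d = d_0` independent of `M ≥ m`, so `d` is orthogonal to all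
`z^s w^k`, `k ≥ 0`, except `z^n`. Hence `|d|² dμ = e₀ dσ` with the trigonometric polynomial `e₀ =
z^{-n} d(z,0)`. Since `μ` may a priori have a singular part, positivity of `e₀` and the absence of
zeros of `d` on `𝕋 × 𝔻̄` are obtained by testing against squared Dirichlet kernels in `z`
(`IsKernel.e₀_re_pos`, `IsKernel.evalEval_ne_zero`). Comparing dual polynomials for `M = m` and `M =
m-1` shows that `d(z,0)` divides the products of the `w`-coefficients of `d` with their reflections
(`exists_kernel`). A rank one Fejér–Riesz theorem (`exists_factorization`) then gives `p` of degree
at most `(n,m)` with `|d|² = e₀|p|²`, whence `dμ = dσ/|p|²`.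

Part (B) is part (A) in coordinates: rows of the inverse moment matrix are the coefficients of the
basis dual to the monomials, and the prescribed zeros are degree drops. -/

open MeasureTheory

noncomputable section

/-! ### Bivariate polynomials on the torus and their Fourier coefficients. -/

namespace BernsteinSzego

open Polynomial ComplexConjugate

/-- Polynomials in `w` whose coefficients are polynomials in `z`. -/
abbrev Bi : Type := ℂ[X][X]

/-- The identification of `ℂ[z, w]` with `ℂ[z][w]`. -/
def toBi : Poly ≃ₐ[ℂ] Bi := (Polynomial.Bivariate.equivMvPolynomial ℂ).symm

theorem toBi_mono (s t : ℕ) : toBi (mono s t) = C (X ^ s) * X ^ t := by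
  simp [toBi, mono]

theorem evalAt_eq_evalEval (f : Poly) (z w : ℂ) : evalAt f z w = (toBi f).evalEval z w := by
  have h : (MvPolynomial.aeval ![z, w] : Poly →ₐ[ℂ] ℂ) =
      (aevalAeval z w).comp (toBi : Poly →ₐ[ℂ] Bi) := by
    apply MvPolynomial.algHom_ext
    intro i
    fin_cases i <;> simp [toBi]
  have := DFunLike.congr_fun h f
  rw [← coe_aevalAeval_eq_evalEval]
  simpa [evalAt, MvPolynomial.aeval_eq_eval] using this

/-- The character `z ^ s * w ^ k` of the torus. -/
def chi (s k : ℤ) (x : Torus) : ℂ := (x.1 : ℂ) ^ s * (x.2 : ℂ) ^ k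

theorem chi_mul_chi (s k s' k' : ℤ) (x : Torus) :
    chi s k x * chi s' k' x = chi (s + s') (k + k') x := by
  simp only [chi, zpow_add₀ (Circle.coe_ne_zero _)]
  ring

theorem conj_chi (s k : ℤ) (x : Torus) : conj (chi s k x) = chi (-s) (-k) x := by
  simp only [chi, map_mul, map_zpow₀, ← Circle.coe_inv_eq_conj, Circle.coe_inv, inv_zpow']

@[simp] theorem norm_chi (s k : ℤ) (x : Torus) : ‖chi s k x‖ = 1 := by
  simp only [chi, norm_mul, norm_zpow, Circle.norm_coe, one_zpow, mul_one]

@[simp] theorem chi_zero_zero (x : Torus) : chi 0 0 x = 1 := by simp [chi]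

@[fun_prop] theorem continuous_chi (s k : ℤ) : Continuous (chi s k) := by
  unfold chi
  have h1 : Continuous fun x : Torus => (x.1 : ℂ) := continuous_subtype_val.comp continuous_fst
  have h2 : Continuous fun x : Torus => (x.2 : ℂ) := continuous_subtype_val.comp continuous_snd
  exact (h1.zpow₀ s fun x => Or.inl (Circle.coe_ne_zero _)).mul
    (h2.zpow₀ k fun x => Or.inl (Circle.coe_ne_zero _))

theorem integrable_torus {E : Type*} [NormedAddCommGroup E] [SecondCountableTopology E]
    {F : Torus → E} (hF : Continuous F) (μ : Measure Torus)
    [IsFiniteMeasure μ] : Integrable F μ :=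
  hF.integrable_of_hasCompactSupport (HasCompactSupport.of_compactSpace _)

/-- The value of a polynomial on the torus. -/
def ev (P : Bi) (x : Torus) : ℂ := P.evalEval (x.1 : ℂ) (x.2 : ℂ)

theorem ev_toBi (f : Poly) (x : Torus) : ev (toBi f) x = evalAt f x.1 x.2 :=
  (evalAt_eq_evalEval f _ _).symm

@[fun_prop] theorem continuous_ev (P : Bi) : Continuous (ev P) := by
  have h := continuous_evalAt (toBi.symm P)
  simpa [← ev_toBi] using h

@[simp] theorem ev_add (P Q : Bi) (x : Torus) : ev (P + Q) x = ev P x + ev Q x := by simp [ev]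
@[simp] theorem ev_sub (P Q : Bi) (x : Torus) : ev (P - Q) x = ev P x - ev Q x := by simp [ev]
@[simp] theorem ev_mul (P Q : Bi) (x : Torus) : ev (P * Q) x = ev P x * ev Q x := by simp [ev]
@[simp] theorem ev_smul (c : ℂ) (P : Bi) (x : Torus) : ev (c • P) x = c * ev P x := by
  simp [ev]
@[simp] theorem ev_C (q : ℂ[X]) (x : Torus) : ev (C q) x = q.eval (x.1 : ℂ) := by
  rw [ev, evalEval_C]
@[simp] theorem ev_X (x : Torus) : ev X x = x.2 := by simp [ev]
@[simp] theorem ev_sum {ι : Type*} (s : Finset ι) (P : ι → Bi) (x : Torus) :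
    ev (∑ i ∈ s, P i) x = ∑ i ∈ s, ev (P i) x := by simp [ev, evalEval_finsetSum]
@[simp] theorem ev_pow (P : Bi) (n : ℕ) (x : Torus) : ev (P ^ n) x = ev P x ^ n := by simp [ev]

/-- `P` has degree at most `N` in `z` and at most `M` in `w`. -/
def Deg (N M : ℕ) (P : Bi) : Prop := ∀ k i, (M < k ∨ N < i) → (P.coeff k).coeff i = 0

theorem Deg.mono {N M N' M' : ℕ} {P : Bi} (h : Deg N M P) (hN : N ≤ N') (hM : M ≤ M') :
    Deg N' M' P := fun k i hki => h k i (by omega)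

theorem deg_zero (N M : ℕ) : Deg N M 0 := fun k i _ => by simp

theorem Deg.add {N M : ℕ} {P Q : Bi} (hP : Deg N M P) (hQ : Deg N M Q) : Deg N M (P + Q) :=
  fun k i h => by simp [hP k i h, hQ k i h]

theorem Deg.sub {N M : ℕ} {P Q : Bi} (hP : Deg N M P) (hQ : Deg N M Q) : Deg N M (P - Q) :=
  fun k i h => by simp [hP k i h, hQ k i h]

theorem Deg.smul {N M : ℕ} {P : Bi} (hP : Deg N M P) (c : ℂ) : Deg N M (c • P) :=
  fun k i h => by simp [hP k i h]

theorem Deg.sum {ι : Type*} {N M : ℕ} {s : Finset ι} {P : ι → Bi}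
    (hP : ∀ i ∈ s, Deg N M (P i)) : Deg N M (∑ i ∈ s, P i) := fun k i h => by
  simp only [finsetSum_coeff]
  exact Finset.sum_eq_zero fun j hj => hP j hj k i h

theorem Deg.coeff_eq_zero {N M : ℕ} {P : Bi} (hP : Deg N M P) {k : ℕ} (hk : M < k) :
    P.coeff k = 0 := by
  ext i
  exact hP k i (Or.inl hk)

theorem Deg.natDegree_coeff_le {N M : ℕ} {P : Bi} (hP : Deg N M P) (k : ℕ) :
    (P.coeff k).natDegree ≤ N :=
  natDegree_le_iff_coeff_eq_zero.2 fun i hi => hP k i (Or.inr hi)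

theorem Deg.natDegree_le {N M : ℕ} {P : Bi} (hP : Deg N M P) : P.natDegree ≤ M :=
  natDegree_le_iff_coeff_eq_zero.2 fun _ hk => hP.coeff_eq_zero hk

theorem deg_iff {N M : ℕ} {P : Bi} :
    Deg N M P ↔ P.natDegree ≤ M ∧ ∀ k, (P.coeff k).natDegree ≤ N := by
  refine ⟨fun h => ⟨h.natDegree_le, h.natDegree_coeff_le⟩, fun h k i hki => ?_⟩
  rcases hki with hk | hi
  · rw [coeff_eq_zero_of_natDegree_lt (h.1.trans_lt hk), coeff_zero]
  · exact coeff_eq_zero_of_natDegree_lt ((h.2 k).trans_lt hi)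

theorem Deg.mul {N M N' M' : ℕ} {P Q : Bi} (hP : Deg N M P) (hQ : Deg N' M' Q) :
    Deg (N + N') (M + M') (P * Q) := by
  rw [deg_iff]
  refine ⟨natDegree_mul_le_of_le hP.natDegree_le hQ.natDegree_le, fun k => ?_⟩
  rw [coeff_mul]
  exact natDegree_sum_le_of_forall_le _ _ fun u _ =>
    natDegree_mul_le_of_le (hP.natDegree_coeff_le _) (hQ.natDegree_coeff_le _)

theorem deg_C {N : ℕ} {q : ℂ[X]} (hq : q.natDegree ≤ N) : Deg N 0 (C q) := by
  rw [deg_iff]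
  refine ⟨by simp, fun k => ?_⟩
  rw [coeff_C]
  split_ifs
  · exact hq
  · simp

theorem deg_X_pow (k : ℕ) : Deg 0 k (X ^ k : Bi) := by
  rw [deg_iff]
  refine ⟨natDegree_X_pow_le _, fun j => ?_⟩
  rw [coeff_X_pow]
  split_ifs <;> simp

theorem Deg.C_mul {N M K : ℕ} {P : Bi} (hP : Deg N M P) {q : ℂ[X]} (hq : q.natDegree ≤ K) :
    Deg (K + N) M (C q * P) := by
  simpa using (deg_C hq).mul hP

theorem Deg.eq_sum {N M : ℕ} {P : Bi} (hP : Deg N M P) :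
    P = ∑ k ∈ Finset.range (M + 1), C (P.coeff k) * X ^ k := by
  conv_lhs => rw [P.as_sum_range_C_mul_X_pow' (Nat.lt_succ_of_le hP.natDegree_le)]

theorem Deg.evalEval_eq {N M : ℕ} {P : Bi} (hP : Deg N M P) (z w : ℂ) :
    P.evalEval z w = ∑ k ∈ Finset.range (M + 1), (P.coeff k).eval z * w ^ k := by
  conv_lhs => rw [hP.eq_sum]
  simp only [evalEval_finsetSum, evalEval_mul, evalEval_C, evalEval_pow, evalEval_X]

theorem Deg.ev_eq {N M : ℕ} {P : Bi} (hP : Deg N M P) (x : Torus) :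
    ev P x = ∑ k ∈ Finset.range (M + 1), ∑ i ∈ Finset.range (N + 1),
      (P.coeff k).coeff i * chi i k x := by
  rw [ev, hP.evalEval_eq]
  refine Finset.sum_congr rfl fun k _ => ?_
  rw [eval_eq_sum_range' (Nat.lt_succ_of_le (hP.natDegree_coeff_le k)), Finset.sum_mul]
  refine Finset.sum_congr rfl fun i _ => ?_
  simp [chi, mul_assoc]

/-- The polynomial with the coefficients `a i k` at `z ^ i * w ^ k`, `i ≤ N`, `k ≤ M`. -/
def ofCoeff (N M : ℕ) (a : ℕ → ℕ → ℂ) : Bi :=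
  ∑ k ∈ Finset.range (M + 1), ∑ i ∈ Finset.range (N + 1), monomial k (monomial i (a i k))

theorem coeff_ofCoeff (N M : ℕ) (a : ℕ → ℕ → ℂ) (k i : ℕ) :
    ((ofCoeff N M a).coeff k).coeff i = if k ≤ M ∧ i ≤ N then a i k else 0 := by
  simp only [ofCoeff, finsetSum_coeff, coeff_monomial, apply_ite (fun p : ℂ[X] => p.coeff i),
    coeff_zero]
  by_cases hk : k ≤ M
  · rw [Finset.sum_eq_single_of_mem k (by simpa using Nat.lt_succ_of_le hk)
      (fun b _ hb => by simp [hb])]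
    by_cases hi : i ≤ N
    · rw [Finset.sum_eq_single_of_mem i (by simpa using Nat.lt_succ_of_le hi)
        (fun b _ hb => by simp [hb])]
      simp [hk, hi]
    · rw [Finset.sum_eq_zero]
      · simp [hi]
      · intro b hb
        have : b ≠ i := by simp at hb; omega
        simp [this]
  · rw [Finset.sum_eq_zero]
    · simp [hk]
    · intro b hb
      have : b ≠ k := by simp at hb; omega
      simp [this]

theorem deg_ofCoeff (N M : ℕ) (a : ℕ → ℕ → ℂ) : Deg N M (ofCoeff N M a) := fun k i h => by
  rw [coeff_ofCoeff, if_neg (by omega)]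

theorem Deg.eq_ofCoeff {N M : ℕ} {P : Bi} (hP : Deg N M P) :
    P = ofCoeff N M fun i k => (P.coeff k).coeff i := by
  ext k i
  rw [coeff_ofCoeff]
  split_ifs with h
  · rfl
  · exact hP k i (by omega)

/-- The coefficient of `F dμ` at `z ^ s * w ^ k`. -/
def fc (μ : Measure Torus) (F : Torus → ℂ) (s k : ℤ) : ℂ := ∫ x, F x * chi (-s) (-k) x ∂μ

/-- The inner product of the polynomial `P` and `z ^ s * w ^ k` in `L²(μ)`. -/
def L (μ : Measure Torus) (P : Bi) (s k : ℤ) : ℂ := fc μ (ev P) s k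

section fc

variable {μ : Measure Torus} [IsFiniteMeasure μ] {F G : Torus → ℂ}

theorem fc_add (hF : Continuous F) (hG : Continuous G) (s k : ℤ) :
    fc μ (fun x => F x + G x) s k = fc μ F s k + fc μ G s k := by
  simp only [fc, add_mul]
  exact integral_add (integrable_torus (by fun_prop) μ) (integrable_torus (by fun_prop) μ)

theorem fc_sub (hF : Continuous F) (hG : Continuous G) (s k : ℤ) :
    fc μ (fun x => F x - G x) s k = fc μ F s k - fc μ G s k := by
  simp only [fc, sub_mul]
  exact integral_sub (integrable_torus (by fun_prop) μ) (integrable_torus (by fun_prop) μ)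

theorem fc_const_mul (c : ℂ) (s k : ℤ) : fc μ (fun x => c * F x) s k = c * fc μ F s k := by
  simp only [fc, mul_assoc]
  exact integral_const_mul _ _

theorem fc_sum {ι : Type*} (t : Finset ι) {F : ι → Torus → ℂ} (hF : ∀ i ∈ t, Continuous (F i))
    (s k : ℤ) : fc μ (fun x => ∑ i ∈ t, F i x) s k = ∑ i ∈ t, fc μ (F i) s k := by
  simp only [fc, Finset.sum_mul]
  exact integral_finsetSum _ fun i hi =>
    integrable_torus ((hF i hi).mul (continuous_chi _ _)) μ

theorem fc_mul_chi (a b s k : ℤ) :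
    fc μ (fun x => F x * chi a b x) s k = fc μ F (s - a) (k - b) := by
  simp only [fc, mul_assoc, chi_mul_chi]
  rw [show a + -s = -(s - a) by ring, show b + -k = -(k - b) by ring]

theorem fc_conj (s k : ℤ) : fc μ (fun x => conj (F x)) s k = conj (fc μ F (-s) (-k)) := by
  simp only [fc]
  rw [← integral_conj]
  simp [conj_chi]

theorem fc_mul_ev (hF : Continuous F) {N M : ℕ} {P : Bi} (hP : Deg N M P) (s k : ℤ) :
    fc μ (fun x => F x * ev P x) s k = ∑ l ∈ Finset.range (M + 1), ∑ i ∈ Finset.range (N + 1),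
      (P.coeff l).coeff i * fc μ F (s - i) (k - l) := by
  simp only [hP.ev_eq, Finset.mul_sum]
  rw [fc_sum _ (fun l _ => by fun_prop)]
  refine Finset.sum_congr rfl fun l _ => ?_
  rw [fc_sum _ (fun l _ => by fun_prop)]
  refine Finset.sum_congr rfl fun i _ => ?_
  rw [← fc_mul_chi, ← fc_const_mul]
  congr! 2
  ring

theorem fc_mul_conj_ev (hF : Continuous F) {N M : ℕ} {P : Bi} (hP : Deg N M P) (s k : ℤ) :
    fc μ (fun x => F x * conj (ev P x)) s k =
      ∑ l ∈ Finset.range (M + 1), ∑ i ∈ Finset.range (N + 1),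
        conj ((P.coeff l).coeff i) * fc μ F (s + i) (k + l) := by
  simp only [hP.ev_eq, Finset.mul_sum, map_sum, map_mul, conj_chi]
  rw [fc_sum _ (fun l _ => by fun_prop)]
  refine Finset.sum_congr rfl fun l _ => ?_
  rw [fc_sum _ (fun l _ => by fun_prop)]
  refine Finset.sum_congr rfl fun i _ => ?_
  rw [show s + (i : ℤ) = s - (-i) by ring, show k + (l : ℤ) = k - (-l) by ring, ← fc_mul_chi,
    ← fc_const_mul]
  congr! 2
  ring

theorem L_add (P Q : Bi) (s k : ℤ) : L μ (P + Q) s k = L μ P s k + L μ Q s k := by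
  simp only [L, ← fc_add (continuous_ev P) (continuous_ev Q), ← ev_add]

theorem L_sub (P Q : Bi) (s k : ℤ) : L μ (P - Q) s k = L μ P s k - L μ Q s k := by
  simp only [L, ← fc_sub (continuous_ev P) (continuous_ev Q), ← ev_sub]

theorem L_smul (c : ℂ) (P : Bi) (s k : ℤ) : L μ (c • P) s k = c * L μ P s k := by
  simp only [L, ← fc_const_mul, ← ev_smul]

theorem L_sum {ι : Type*} (t : Finset ι) (P : ι → Bi) (s k : ℤ) :
    L μ (∑ i ∈ t, P i) s k = ∑ i ∈ t, L μ (P i) s k := by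
  simp only [L, ← fc_sum t (fun i _ => continuous_ev (P i)), ← ev_sum]

theorem L_C_X_mul (P : Bi) (s k : ℤ) : L μ (C X * P) s k = L μ P (s - 1) k := by
  have h : ev (C X * P) = fun x => ev P x * chi 1 0 x := by
    funext x
    rw [ev_mul, mul_comm]
    simp [chi]
  rw [L, L, h, fc_mul_chi, sub_zero]

theorem L_X_mul (P : Bi) (s k : ℤ) : L μ (X * P) s k = L μ P s (k - 1) := by
  have h : ev (X * P) = fun x => ev P x * chi 0 1 x := by
    funext x
    rw [ev_mul, mul_comm]
    simp [chi]
  rw [L, L, h, fc_mul_chi, sub_zero]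

theorem L_C_X_pow_mul (P : Bi) (j : ℕ) (s k : ℤ) :
    L μ (C (X ^ j) * P) s k = L μ P (s - j) k := by
  have h : ev (C (X ^ j) * P) = fun x => ev P x * chi j 0 x := by
    funext x
    rw [ev_mul, mul_comm]
    simp [chi]
  rw [L, L, h, fc_mul_chi, sub_zero]

theorem L_C_mul (q : ℂ[X]) (P : Bi) (s k : ℤ) :
    L μ (C q * P) s k =
      ∑ i ∈ Finset.range (q.natDegree + 1), q.coeff i * L μ P (s - i) k := by
  have h := fc_mul_ev (μ := μ) (continuous_ev P) (deg_C (q := q) le_rfl) s k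
  simp only [zero_add, Finset.range_one, Finset.sum_singleton, coeff_C_zero, Nat.cast_zero,
    sub_zero] at h
  simp only [L, ← h]
  congr! 2 with x
  rw [ev_mul, mul_comm]

end fc

end BernsteinSzego

/-! ### The spaces `E²` and `H` in coordinates; nondegeneracy. -/

namespace BernsteinSzego

open Polynomial ComplexConjugate

theorem evalAt_mono (s t : ℕ) (x : Torus) : evalAt (mono s t) x.1 x.2 = chi s t x := by
  simp [evalAt, mono, chi]

theorem ip_mono (μ : Measure Torus) (f : Poly) (s t : ℕ) :
    ip μ f (mono s t) = L μ (toBi f) s t := by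
  simp only [ip, L, fc, ev_toBi, evalAt_mono, conj_chi]

theorem ip_span_eq_zero_iff (μ : Measure Torus) [IsFiniteMeasure μ] (f : Poly) (S : Set Poly) :
    (∀ g ∈ Submodule.span ℂ S, ip μ f g = 0) ↔ ∀ g ∈ S, ip μ f g = 0 := by
  refine ⟨fun h g hg => h g (Submodule.subset_span hg), fun h g hg => ?_⟩
  induction hg using Submodule.span_induction with
  | mem x hx => exact h x hx
  | zero => simp [ip, evalAt]
  | add a b _ _ ha hb =>
    have h1 : ip μ f (a + b) = ip μ f a + ip μ f b := by
      unfold ip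
      rw [← integral_add (integrable_ip μ f a) (integrable_ip μ f b)]
      simp [evalAt, mul_add]
    rw [h1, ha, hb, add_zero]
  | smul c a _ ha =>
    have h1 : ip μ f (c • a) = conj c * ip μ f a := by
      unfold ip
      rw [← integral_const_mul]
      simp only [evalAt, MvPolynomial.smul_eval, map_mul]
      congr! 2
      ring
    rw [h1, ha, mul_zero]

theorem toBi_symm_ofCoeff (N M : ℕ) (a : ℕ → ℕ → ℂ) :
    toBi.symm (ofCoeff N M a) =
      ∑ k ∈ Finset.range (M + 1), ∑ i ∈ Finset.range (N + 1), a i k • mono i k := by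
  apply toBi.injective
  rw [AlgEquiv.apply_symm_apply, map_sum, ofCoeff]
  refine Finset.sum_congr rfl fun k _ => ?_
  rw [map_sum]
  refine Finset.sum_congr rfl fun i _ => ?_
  rw [map_smul, toBi_mono, ← C_mul_X_pow_eq_monomial, ← C_mul_X_pow_eq_monomial,
    ← smul_mul_assoc, smul_C, smul_eq_C_mul]

theorem mem_polySpace_iff (f : Poly) (N M : ℕ) :
    f ∈ polySpace N M ↔ Deg N M (toBi f) := by
  constructor
  · intro hf
    induction hf using Submodule.span_induction with
    | mem x hx =>
      obtain ⟨s, t, hs, ht, rfl⟩ := hx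
      rw [toBi_mono]
      refine ((deg_X_pow t).C_mul (natDegree_X_pow_le s)).mono ?_ ?_ <;> omega
    | zero => simpa using deg_zero N M
    | add a b _ _ ha hb => simpa using ha.add hb
    | smul c a _ ha => simpa using ha.smul c
  · intro h
    rw [← toBi.symm_apply_apply f, h.eq_ofCoeff, toBi_symm_ofCoeff]
    refine Submodule.sum_mem _ fun k hk => Submodule.sum_mem _ fun i hi =>
      Submodule.smul_mem _ _ (Submodule.subset_span ⟨i, k, ?_, ?_, rfl⟩)
    · simp at hi; omega
    · simp at hk; omega

theorem degreeLE_iff (f : Poly) (N M : ℕ) : DegreeLE f N M ↔ Deg N M (toBi f) := by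
  rw [← mem_polySpace_iff]
  have hmono : ∀ d : Fin 2 →₀ ℕ, MvPolynomial.monomial d (1 : ℂ) = mono (d 0) (d 1) := by
    intro d
    rw [MvPolynomial.monomial_eq, Finsupp.prod_fintype _ _ (by simp)]
    simp [mono]
  constructor
  · intro h
    rw [DegreeLE, MvPolynomial.degreeOf_le_iff, MvPolynomial.degreeOf_le_iff] at h
    rw [f.as_sum]
    refine Submodule.sum_mem _ fun d hd => ?_
    have : MvPolynomial.monomial d (f.coeff d) = f.coeff d • mono (d 0) (d 1) := by
      rw [← hmono, MvPolynomial.smul_monomial, smul_eq_mul, mul_one]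
    rw [this]
    exact Submodule.smul_mem _ _ (Submodule.subset_span
      ⟨_, _, by exact_mod_cast h.1 d hd, by exact_mod_cast h.2 d hd, rfl⟩)
  · intro h
    induction h using Submodule.span_induction with
    | mem x hx =>
      obtain ⟨s, t, hs, ht, rfl⟩ := hx
      have hs' : s ≤ N := by omega
      have ht' : t ≤ M := by omega
      constructor
      · refine (MvPolynomial.degreeOf_mul_le _ _ _).trans ?_
        refine (add_le_add (MvPolynomial.degreeOf_pow_le _ _ _)
          (MvPolynomial.degreeOf_pow_le _ _ _)).trans ?_
        simpa [MvPolynomial.degreeOf_X] using hs'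
      · refine (MvPolynomial.degreeOf_mul_le _ _ _).trans ?_
        refine (add_le_add (MvPolynomial.degreeOf_pow_le _ _ _)
          (MvPolynomial.degreeOf_pow_le _ _ _)).trans ?_
        simpa [MvPolynomial.degreeOf_X] using ht'
    | zero => simp [DegreeLE]
    | add a b _ _ ha hb =>
      exact ⟨(MvPolynomial.degreeOf_add_le _ _ _).trans (max_le ha.1 hb.1),
        (MvPolynomial.degreeOf_add_le _ _ _).trans (max_le ha.2 hb.2)⟩
    | smul c a _ ha =>
      rw [MvPolynomial.smul_eq_C_mul]
      exact ⟨(MvPolynomial.degreeOf_C_mul_le _ _ _).trans ha.1,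
        (MvPolynomial.degreeOf_C_mul_le _ _ _).trans ha.2⟩

/-- `P ∈ P_{N,M}` is orthogonal to `z ^ s * w ^ k`, `1 ≤ s ≤ N`, `k ≤ M`. -/
def MemE (μ : Measure Torus) (N M : ℕ) (P : Bi) : Prop :=
  Deg N M P ∧ ∀ s k : ℕ, 1 ≤ s → s ≤ N → k ≤ M → L μ P s k = 0

/-- `P ∈ P_{2n,M}` is orthogonal to all `z ^ s * w ^ k`, `s ≤ 2n`, `k ≤ M`, except `z ^ n`. -/
def MemH (μ : Measure Torus) (n M : ℕ) (P : Bi) : Prop :=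
  Deg (2 * n) M P ∧ ∀ s k : ℕ, s ≤ 2 * n → k ≤ M → (s, k) ≠ (n, 0) → L μ P s k = 0

theorem mem_spaceE_iff (μ : Measure Torus) [IsFiniteMeasure μ] (f : Poly) (N M : ℕ) :
    f ∈ spaceE μ N M ↔ MemE μ N M (toBi f) := by
  have h : (f ∈ spaceE μ N M) ↔ f ∈ polySpace N M ∧ ∀ g ∈ (polySpace ((N : ℤ) - 1) M).map
      (LinearMap.mulLeft ℂ (MvPolynomial.X 0 : Poly)), ip μ f g = 0 := Iff.rfl
  rw [h, mem_polySpace_iff, polySpace, Submodule.map_span, ip_span_eq_zero_iff]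
  have hm : ∀ s t : ℕ, (MvPolynomial.X 0 : Poly) * mono s t = mono (s + 1) t := fun s t => by
    simp only [mono]; ring
  refine and_congr_right fun _ => ⟨fun h s k h1 hs hk => ?_, ?_⟩
  · rw [← ip_mono]
    refine h _ ⟨mono (s - 1) k, ⟨s - 1, k, by omega, by omega, rfl⟩, ?_⟩
    rw [LinearMap.mulLeft_apply, hm, Nat.sub_add_cancel h1]
  · rintro h _ ⟨_, ⟨s, t, hs, ht, rfl⟩, rfl⟩
    rw [LinearMap.mulLeft_apply, hm, ip_mono]
    exact h _ _ (by omega) (by omega) (by omega)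

theorem mem_spaceH_iff (μ : Measure Torus) [IsFiniteMeasure μ] (f : Poly) (n M : ℕ) :
    f ∈ spaceH μ n M ↔ MemH μ n M (toBi f) := by
  have h : (f ∈ spaceH μ n M) ↔ f ∈ polySpace (2 * n) M ∧ ∀ g ∈ Submodule.span ℂ
      {f | ∃ s t : ℕ, s ≤ 2 * n ∧ t ≤ M ∧ (s, t) ≠ (n, 0) ∧ f = mono s t}, ip μ f g = 0 := Iff.rfl
  have h2 : ((2 : ℤ) * n) = ((2 * n : ℕ) : ℤ) := by push_cast; rfl
  rw [h, h2, mem_polySpace_iff, ip_span_eq_zero_iff]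
  refine and_congr_right fun _ => ⟨fun h s k hs hk hsk => ?_, ?_⟩
  · rw [← ip_mono]
    exact h _ ⟨s, k, hs, hk, hsk, rfl⟩
  · rintro h _ ⟨s, t, hs, ht, hst, rfl⟩
    rw [ip_mono]
    exact h _ _ hs ht hst

theorem spaceE_eq_iff (μ : Measure Torus) [IsFiniteMeasure μ] (N N' M : ℕ) :
    spaceE μ N M = spaceE μ N' M ↔ ∀ P, MemE μ N M P ↔ MemE μ N' M P := by
  rw [SetLike.ext_iff]
  simp only [mem_spaceE_iff]
  exact ⟨fun h P => by simpa using h (toBi.symm P), fun h f => h _⟩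

theorem spaceH_eq_iff (μ : Measure Torus) [IsFiniteMeasure μ] (n M M' : ℕ) :
    spaceH μ n M = spaceH μ n M' ↔ ∀ P, MemH μ n M P ↔ MemH μ n M' P := by
  rw [SetLike.ext_iff]
  simp only [mem_spaceH_iff]
  exact ⟨fun h P => by simpa using h (toBi.symm P), fun h f => h _⟩

theorem polySpace_neg_one (k : ℤ) : polySpace k (-1) = ⊥ := by
  rw [polySpace, Submodule.span_eq_bot]
  rintro x ⟨s, t, _, ht, _⟩
  omega

theorem spaceE_neg_one (μ : Measure Torus) [IsFiniteMeasure μ] (k : ℤ) :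
    spaceE μ k (-1) = ⊥ := by
  rw [eq_bot_iff]
  rintro f ⟨hf, -⟩
  rwa [polySpace_neg_one] at hf

/-- For `N ≥ n` the space `E²_{N,M}` is contained in `P_{n,M}` and is orthogonal to all
`z ^ s * w ^ k`, `s ≥ 1`, `k ≤ M`. -/
def EStable (μ : Measure Torus) (n M : ℕ) : Prop :=
  ∀ N P, n ≤ N → MemE μ N M P →
    Deg n M P ∧ ∀ s k : ℕ, 1 ≤ s → k ≤ M → L μ P s k = 0

/-- If the spaces coincide, membership in the first one bounds the degree, and membership in
`E²_{n+s,M}` gives orthogonality to `z^s w^k`. -/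
theorem eStable_iff (μ : Measure Torus) [IsFiniteMeasure μ] (n M : ℕ) :
    EStable μ n M ↔ ∀ j : ℕ, spaceE μ n M = spaceE μ (n + j) M := by
  have hc : ∀ j : ℕ, ((n : ℤ) + j) = ((n + j : ℕ) : ℤ) := fun j => by push_cast; rfl
  simp only [hc, spaceE_eq_iff]
  constructor
  · refine fun h j P => ⟨fun hP => ?_, fun hP => ?_⟩
    · have := h n P le_rfl hP
      exact ⟨this.1.mono (by omega) le_rfl, fun s k h1 _ hk => this.2 s k h1 hk⟩
    · have := h (n + j) P (by omega) hP
      exact ⟨this.1, fun s k h1 _ hk => this.2 s k h1 hk⟩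
  · intro h N P hN hP
    obtain ⟨j, rfl⟩ := Nat.exists_eq_add_of_le hN
    have hP' := (h j P).2 hP
    exact ⟨hP'.1, fun s k h1 hk => ((h s P).1 hP').2 s k h1 (by omega) hk⟩

/-- Integer indices add only `M = -1`, which occurs for `m = 0`; all spaces are then zero. -/
theorem eStable_int_iff (μ : Measure Torus) [IsFiniteMeasure μ] (n m : ℕ) :
    (∀ (M : ℤ) (j : ℕ), (m : ℤ) - 1 ≤ M → spaceE μ n M = spaceE μ (n + j) M) ↔
      ∀ M : ℕ, m ≤ M + 1 → EStable μ n M := by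
  simp only [eStable_iff]
  refine ⟨fun h M hM j => h M j (by omega), fun h M j hM => ?_⟩
  rcases lt_or_ge M 0 with hM0 | hM0
  · obtain rfl : M = -1 := by omega
    rw [spaceE_neg_one, spaceE_neg_one]
  · lift M to ℕ using hM0
    exact h M (by omega) j

/-- The spaces `H_M`, `M ≥ m`, coincide. -/
def HStable (μ : Measure Torus) (n m : ℕ) : Prop :=
  ∀ M P, m ≤ M → (MemH μ n m P ↔ MemH μ n M P)

theorem hStable_iff (μ : Measure Torus) [IsFiniteMeasure μ] (n m : ℕ) :
    HStable μ n m ↔ ∀ j : ℕ, spaceH μ n m = spaceH μ n (m + j) := by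
  simp only [spaceH_eq_iff]
  refine ⟨fun h j P => h _ P (by omega), fun h M P hM => ?_⟩
  obtain ⟨j, rfl⟩ := Nat.exists_eq_add_of_le hM
  exact h j P

theorem norm_sq_eq_fc (μ : Measure Torus) (F : Torus → ℂ) :
    ((∫ x, ‖F x‖ ^ 2 ∂μ : ℝ) : ℂ) = fc μ (fun x => F x * conj (F x)) 0 0 := by
  simp only [fc, neg_zero, chi_zero_zero, mul_one, Complex.mul_conj']
  rw [← integral_complex_ofReal]
  simp

theorem nonDegenerate_iff (μ : Measure Torus) :
    NonDegenerate μ ↔ ∀ P : Bi, ∫ x, ‖ev P x‖ ^ 2 ∂μ = 0 → P = 0 := by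
  constructor
  · intro h P hP
    by_contra h0
    have := h (toBi.symm P) (by simpa using h0)
    simp only [← ev_toBi, AlgEquiv.apply_symm_apply] at this
    exact this.ne' hP
  · intro h f hf
    refine lt_of_le_of_ne (integral_nonneg fun x => by positivity) fun h0 => hf ?_
    have := h (toBi f) (by simpa only [ev_toBi] using h0.symm)
    simpa using this

section NonDegenerate

variable {μ : Measure Torus} [IsFiniteMeasure μ]

theorem fc_ev_mul_conj_ev (P : Bi) {N M : ℕ} {Q : Bi} (hQ : Deg N M Q) (s k : ℤ) :
    fc μ (fun x => ev P x * conj (ev Q x)) s k =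
      ∑ l ∈ Finset.range (M + 1), ∑ i ∈ Finset.range (N + 1),
        conj ((Q.coeff l).coeff i) * L μ P (s + i) (k + l) :=
  fc_mul_conj_ev (continuous_ev P) hQ s k

/-- The squared norm of `P` is a combination of the `L μ P i l` weighted by the conjugate
coefficients, so orthogonality is needed only on the support of `P`. `exists_kernel` uses this
sharper form. -/
theorem NonDegenerate.eq_zero (hμ : NonDegenerate μ) {N M : ℕ} {P : Bi} (hP : Deg N M P)
    (h : ∀ l i : ℕ, (P.coeff l).coeff i ≠ 0 → L μ P i l = 0) : P = 0 := by
  refine (nonDegenerate_iff μ).1 hμ P ?_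
  have h1 := norm_sq_eq_fc μ (ev P)
  rw [fc_ev_mul_conj_ev P hP, Finset.sum_eq_zero] at h1
  · exact_mod_cast h1
  · refine fun l _ => Finset.sum_eq_zero fun i _ => ?_
    by_cases h0 : (P.coeff l).coeff i = 0
    · simp [h0]
    · simp [h l i h0]

theorem NonDegenerate.eq_zero_of_L (hμ : NonDegenerate μ) {N M : ℕ} {P : Bi} (hP : Deg N M P)
    (h : ∀ i l : ℕ, i ≤ N → l ≤ M → L μ P i l = 0) : P = 0 :=
  hμ.eq_zero hP fun l i h0 => h i l
    (by by_contra hi; exact h0 (hP l i (by omega))) (by by_contra hi; exact h0 (hP l i (by omega)))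

theorem NonDegenerate.eq_of_L (hμ : NonDegenerate μ) {N M : ℕ} {P Q : Bi} (hP : Deg N M P)
    (hQ : Deg N M Q) (h : ∀ i l : ℕ, i ≤ N → l ≤ M → L μ P i l = L μ Q i l) : P = Q :=
  sub_eq_zero.1 <| hμ.eq_zero_of_L (hP.sub hQ) fun i l hi hl => by
    rw [L_sub, h i l hi hl, sub_self]

/-- Extension of a function on `Fin (N + 1) × Fin (M + 1)` by zero. -/
def extend {N M : ℕ} (a : Fin (N + 1) × Fin (M + 1) → ℂ) (i k : ℕ) : ℂ :=
  if h : i < N + 1 ∧ k < M + 1 then a (⟨i, h.1⟩, ⟨k, h.2⟩) else 0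

theorem extend_apply {N M : ℕ} (a : Fin (N + 1) × Fin (M + 1) → ℂ) (u) :
    extend a (u.1 : ℕ) (u.2 : ℕ) = a u := by
  rw [extend, dif_pos ⟨u.1.2, u.2.2⟩]

/-- The map from coefficients to inner products is a square linear map, injective by nondegeneracy,
hence surjective. -/
theorem NonDegenerate.exists_L (hμ : NonDegenerate μ) (N M : ℕ) (b : ℕ → ℕ → ℂ) :
    ∃ P, Deg N M P ∧ ∀ i l : ℕ, i ≤ N → l ≤ M → L μ P i l = b i l := by
  have hadd : ∀ a b : Fin (N + 1) × Fin (M + 1) → ℂ,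
      ofCoeff N M (extend (a + b)) = ofCoeff N M (extend a) + ofCoeff N M (extend b) := by
    intro a b
    ext k i
    simp only [coeff_add, coeff_ofCoeff, extend]
    split_ifs <;> simp
  have hsmul : ∀ (c : ℂ) (a : Fin (N + 1) × Fin (M + 1) → ℂ),
      ofCoeff N M (extend (c • a)) = c • ofCoeff N M (extend a) := by
    intro c a
    ext k i
    simp only [coeff_smul, coeff_ofCoeff, extend]
    split_ifs <;> simp
  let T : (Fin (N + 1) × Fin (M + 1) → ℂ) →ₗ[ℂ] (Fin (N + 1) × Fin (M + 1) → ℂ) :=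
    { toFun := fun a u => L μ (ofCoeff N M (extend a)) (u.1 : ℕ) (u.2 : ℕ)
      map_add' := fun a b => by
        funext u
        rw [hadd, L_add]
        rfl
      map_smul' := fun c a => by
        funext u
        rw [hsmul, L_smul]
        rfl }
  have hT : Function.Injective T := by
    rw [← LinearMap.ker_eq_bot, LinearMap.ker_eq_bot']
    intro a ha
    have h0 : ofCoeff N M (extend a) = 0 := by
      refine hμ.eq_zero_of_L (deg_ofCoeff N M _) fun i l hi hl => ?_
      exact congrFun ha (⟨i, by omega⟩, ⟨l, by omega⟩)
    funext u
    have := coeff_ofCoeff N M (extend a) u.2 u.1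
    rw [h0, if_pos ⟨by omega, by omega⟩, extend_apply] at this
    simpa using this.symm
  obtain ⟨a, ha⟩ := (LinearMap.injective_iff_surjective.1 hT) fun u => b u.1 u.2
  exact ⟨_, deg_ofCoeff N M (extend a), fun i l hi hl =>
    congrFun ha (⟨i, by omega⟩, ⟨l, by omega⟩)⟩

end NonDegenerate

end BernsteinSzego

/-! ### Moment matrices and their inverses. -/

namespace BernsteinSzego

open Polynomial ComplexConjugate

theorem exists_deg (P : Bi) : ∃ N M, Deg N M P := by
  refine ⟨P.support.sup fun k => (P.coeff k).natDegree, P.natDegree, deg_iff.2 ⟨le_rfl, fun k => ?_⟩⟩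
  by_cases hk : k ∈ P.support
  · exact Finset.le_sup (f := fun k => (P.coeff k).natDegree) hk
  · rw [notMem_support_iff.1 hk]
    simp

section Matrix

variable {μ : Measure Torus} [IsFiniteMeasure μ]

theorem momentMatrix_apply (μ : Measure Torus) (N M : ℕ) (u v : Fin (N + 1) × Fin (M + 1)) :
    momentMatrix μ N M u v = fc μ (fun _ => 1) ((v.1 : ℕ) - (u.1 : ℕ)) ((v.2 : ℕ) - (u.2 : ℕ)) := by
  simp [momentMatrix, moment, fc, chi]

theorem Deg.L_eq {N M : ℕ} {P : Bi} (hP : Deg N M P) (s k : ℤ) :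
    L μ P s k = ∑ l ∈ Finset.range (M + 1), ∑ i ∈ Finset.range (N + 1),
      (P.coeff l).coeff i * fc μ (fun _ => 1) (s - i) (k - l) := by
  rw [← fc_mul_ev continuous_const hP]
  simp only [one_mul]
  rfl

/-- With entries `c_{v-u}`, coefficient vectors act as rows from the left; this is why rows of the
inverse give dual polynomials. -/
theorem L_ofCoeff_extend {N M : ℕ} (a : Fin (N + 1) × Fin (M + 1) → ℂ)
    (v : Fin (N + 1) × Fin (M + 1)) :
    L μ (ofCoeff N M (extend a)) (v.1 : ℕ) (v.2 : ℕ) =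
      Matrix.vecMul a (momentMatrix μ N M) v := by
  rw [(deg_ofCoeff N M _).L_eq, Matrix.vecMul, dotProduct, Fintype.sum_prod_type_right,
    Finset.sum_range]
  refine Finset.sum_congr rfl fun l _ => ?_
  rw [Finset.sum_range]
  refine Finset.sum_congr rfl fun i _ => ?_
  rw [coeff_ofCoeff, if_pos ⟨by omega, by omega⟩, extend_apply a (i, l), momentMatrix_apply]

theorem ofCoeff_extend_eq_zero {N M : ℕ} {a : Fin (N + 1) × Fin (M + 1) → ℂ}
    (h : ofCoeff N M (extend a) = 0) : a = 0 := by
  funext u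
  have := coeff_ofCoeff N M (extend a) u.2 u.1
  rw [h, if_pos ⟨by omega, by omega⟩, extend_apply] at this
  simpa using this.symm

theorem Deg.eq_ofCoeff_extend {N M : ℕ} {P : Bi} (hP : Deg N M P) :
    P = ofCoeff N M
      (extend fun u : Fin (N + 1) × Fin (M + 1) => (P.coeff u.2).coeff u.1) := by
  ext k i
  rw [coeff_ofCoeff]
  split_ifs with h
  · rw [extend, dif_pos ⟨by omega, by omega⟩]
  · exact hP k i (by omega)

/-- A polynomial of norm zero vanishes almost everywhere, so its coefficients form a left null
vector. Conversely, a left null vector is a polynomial orthogonal to every monomial in its own box.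
-/
theorem det_ne_zero_iff : (∀ N M, (momentMatrix μ N M).det ≠ 0) ↔ NonDegenerate μ := by
  constructor
  · intro h
    rw [nonDegenerate_iff]
    intro P hP
    obtain ⟨N, M, hd⟩ := exists_deg P
    have hint : Integrable (fun x => ‖ev P x‖ ^ 2) μ := integrable_torus (by fun_prop) μ
    rw [integral_eq_zero_iff_of_nonneg (fun x => by positivity) hint] at hP
    have hL : ∀ s k, L μ P s k = 0 := by
      intro s k
      rw [L, fc, ← integral_zero Torus ℂ (μ := μ)]
      refine integral_congr_ae ?_
      filter_upwards [hP] with x hx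
      have : ev P x = 0 := by simpa using hx
      simp [this]
    have ha : Matrix.vecMul (fun u : Fin (N + 1) × Fin (M + 1) => (P.coeff u.2).coeff u.1)
        (momentMatrix μ N M) = 0 := by
      funext v
      rw [← L_ofCoeff_extend, ← hd.eq_ofCoeff_extend, hL]
      rfl
    rw [hd.eq_ofCoeff_extend, Matrix.eq_zero_of_vecMul_eq_zero (h N M) ha]
    ext k i
    rw [coeff_ofCoeff]
    simp [extend]
  · intro hμ N M hdet
    obtain ⟨a, ha0, ha⟩ := Matrix.exists_vecMul_eq_zero_iff.2 hdet
    refine ha0 (ofCoeff_extend_eq_zero (hμ.eq_zero_of_L (deg_ofCoeff N M _) fun i l hi hl => ?_))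
    have := L_ofCoeff_extend (μ := μ) a (⟨i, by omega⟩, ⟨l, by omega⟩)
    rw [ha] at this
    exact this

/-- The polynomial whose coefficients are the entries of a row of the inverse moment matrix. -/
def dual (μ : Measure Torus) (N M : ℕ) (u : Fin (N + 1) × Fin (M + 1)) : Bi :=
  ofCoeff N M (extend ((momentMatrix μ N M)⁻¹ u))

theorem deg_dual (N M : ℕ) (u) : Deg N M (dual μ N M u) := deg_ofCoeff N M _

theorem coeff_dual (N M : ℕ) (u v : Fin (N + 1) × Fin (M + 1)) :
    ((dual μ N M u).coeff v.2).coeff v.1 = (momentMatrix μ N M)⁻¹ u v := by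
  rw [dual, coeff_ofCoeff, if_pos ⟨by omega, by omega⟩, extend_apply]

theorem NonDegenerate.L_dual (hμ : NonDegenerate μ) {N M : ℕ} (u : Fin (N + 1) × Fin (M + 1))
    {s k : ℕ} (hs : s ≤ N) (hk : k ≤ M) :
    L μ (dual μ N M u) s k = if (s = u.1 ∧ k = u.2) then 1 else 0 := by
  have h := L_ofCoeff_extend (μ := μ) ((momentMatrix μ N M)⁻¹ u) (⟨s, by omega⟩, ⟨k, by omega⟩)
  have h2 := congrFun (congrFun (Matrix.nonsing_inv_mul (momentMatrix μ N M)
    (isUnit_iff_ne_zero.2 (det_ne_zero_iff.2 hμ N M))) u) (⟨s, by omega⟩, ⟨k, by omega⟩)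
  rw [dual]
  refine h.trans (Eq.trans ?_ (h2.trans ?_))
  · rfl
  · rw [Matrix.one_apply]
    refine if_congr ?_ rfl rfl
    rw [Prod.ext_iff, Fin.ext_iff, Fin.ext_iff]
    exact ⟨fun h => ⟨h.1.symm, h.2.symm⟩, fun h => ⟨h.1.symm, h.2.symm⟩⟩

theorem eStable_of_step {n M : ℕ}
    (h : ∀ N P, n ≤ N → (MemE μ N M P ↔ MemE μ (N + 1) M P)) : EStable μ n M := by
  have h' : ∀ N P, n ≤ N → (MemE μ n M P ↔ MemE μ N M P) := by
    intro N P hN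
    induction N, hN using Nat.le_induction with
    | base => rfl
    | succ N hN ih => rw [ih, h N P hN]
  intro N P hN hP
  have hP' := (h' N P hN).2 hP
  exact ⟨hP'.1, fun s k h1 hk => ((h' (n + s) P (by omega)).1 hP').2 s k h1 (by omega) hk⟩

/-- The duals of the `w^j` span `E²_{N+1,M}`. The entries in question are their coefficients at
`z^{N+1}`; when these vanish, the same polynomials span `E²_{N,M}`. -/
theorem NonDegenerate.eStable_iff_inv (hμ : NonDegenerate μ) (n M : ℕ) :
    EStable μ n M ↔ ∀ N, n ≤ N → ∀ j k : Fin (M + 1),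
      (momentMatrix μ (N + 1) M)⁻¹ (0, j) (Fin.last (N + 1), k) = 0 := by
  have hE : ∀ N (j : Fin (M + 1)), MemE μ (N + 1) M (dual μ (N + 1) M (0, j)) := fun N j =>
    ⟨deg_dual _ _ _, fun s k h1 hs hk => by
      rw [hμ.L_dual _ hs hk, if_neg]
      rintro ⟨h, -⟩
      simp at h
      omega⟩
  constructor
  · intro h N hN j k
    rw [← coeff_dual]
    exact (h (N + 1) _ (by omega) (hE N j)).1 _ _ (Or.inr (by simp; omega))
  · intro h
    refine eStable_of_step fun N P hN => ?_
    have hdeg : ∀ j : Fin (M + 1), Deg N M (dual μ (N + 1) M (0, j)) := by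
      intro j k i hki
      rcases Nat.lt_or_ge M k with hk | hk
      · exact deg_dual (N + 1) M _ k i (Or.inl hk)
      · rcases Nat.lt_or_ge (N + 1) i with hi | hi
        · exact deg_dual (N + 1) M _ k i (Or.inr hi)
        · obtain rfl : i = N + 1 := by omega
          exact (coeff_dual (N + 1) M (0, j) (Fin.last (N + 1), ⟨k, by omega⟩)).trans
            (h N hN j ⟨k, by omega⟩)
    have hdual : MemE μ N M P →
        P = ∑ j : Fin (M + 1), L μ P 0 (j : ℕ) • dual μ (N + 1) M (0, j) := by
      intro hP
      refine hμ.eq_of_L hP.1 (Deg.sum fun j _ => (hdeg j).smul _) fun i l hi hl => ?_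
      rw [L_sum]
      simp only [L_smul, hμ.L_dual _ (show i ≤ N + 1 by omega) hl]
      rcases Nat.eq_zero_or_pos i with rfl | hi0
      · rw [Finset.sum_eq_single (⟨l, by omega⟩ : Fin (M + 1))]
        · simp
        · intro b _ hb
          rw [if_neg, mul_zero]
          rintro ⟨-, hb'⟩
          exact hb (Fin.ext hb'.symm)
        · simp
      · rw [hP.2 i l hi0 hi hl, Finset.sum_eq_zero]
        intro j _
        rw [if_neg, mul_zero]
        rintro ⟨h, -⟩
        simp at h
        omega
    have hsum : ∀ c : Fin (M + 1) → ℂ,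
        MemE μ (N + 1) M (∑ j : Fin (M + 1), c j • dual μ (N + 1) M (0, j)) := fun c =>
      ⟨Deg.sum fun j _ => (deg_dual _ _ _).smul _, fun s k h1 hs hk => by
        rw [L_sum]
        exact Finset.sum_eq_zero fun j _ => by rw [L_smul, (hE N j).2 s k h1 hs hk, mul_zero]⟩
    constructor
    · intro hP
      rw [hdual hP]
      exact hsum _
    · intro hP
      refine ⟨?_, fun s k h1 hs hk => hP.2 s k h1 (by omega) hk⟩
      have : P = ∑ j : Fin (M + 1), L μ P 0 (j : ℕ) • dual μ (N + 1) M (0, j) := by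
        refine hμ.eq_of_L hP.1 (hsum _).1 fun i l hi hl => ?_
        rcases Nat.eq_zero_or_pos i with rfl | hi0
        · rw [L_sum]
          simp only [L_smul, hμ.L_dual _ hi hl]
          rw [Finset.sum_eq_single (⟨l, by omega⟩ : Fin (M + 1))]
          · simp
          · intro b _ hb
            rw [if_neg, mul_zero]
            rintro ⟨-, hb'⟩
            exact hb (Fin.ext hb'.symm)
          · simp
        · rw [hP.2 i l hi0 hi hl, (hsum _).2 i l hi0 hi hl]
      rw [this]
      exact Deg.sum fun j _ => (hdeg j).smul _

/-- Elements of `H_M` are determined by their inner product with `z ^ n`. -/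
theorem NonDegenerate.memH_eq_smul (hμ : NonDegenerate μ) {n M : ℕ} {P Q : Bi}
    (hP : MemH μ n M P) (hQ : MemH μ n M Q) (h1 : L μ Q n 0 = 1) : P = L μ P n 0 • Q := by
  refine hμ.eq_of_L hP.1 (hQ.1.smul _) fun i l hi hl => ?_
  rw [L_smul]
  by_cases h : (i, l) = (n, 0)
  · obtain ⟨hi', hl'⟩ := Prod.mk.inj h
    rw [hi', hl', Nat.cast_zero, h1, mul_one]
  · rw [hP.2 i l hi hl h, hQ.2 i l hi hl h, mul_zero]

theorem MemH.smul {n M : ℕ} {P : Bi} (hP : MemH μ n M P) (c : ℂ) : MemH μ n M (c • P) :=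
  ⟨hP.1.smul c, fun s k hs hk h => by rw [L_smul, hP.2 s k hs hk h, mul_zero]⟩

/-- Each `H_M` is the line spanned by the dual of `z^n`. When the `w^{M+1}`-coefficients of the
generator of `H_{M+1}` vanish, it generates `H_M` as well. -/
theorem NonDegenerate.hStable_iff_inv (hμ : NonDegenerate μ) (n m : ℕ) (hn : n < 2 * n + 1) :
    HStable μ n m ↔ ∀ M, m < M → ∀ j : Fin (2 * n + 1),
      (momentMatrix μ (2 * n) M)⁻¹ (⟨n, hn⟩, 0) (j, Fin.last M) = 0 := by
  let d : ∀ M, Bi := fun M => dual μ (2 * n) M (⟨n, hn⟩, 0)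
  have hd : ∀ M, MemH μ n M (d M) := fun M => ⟨deg_dual _ _ _, fun s k hs hk hsk => by
    rw [hμ.L_dual _ hs hk, if_neg]
    simpa using hsk⟩
  have hd1 : ∀ M, L μ (d M) n 0 = 1 := fun M =>
    (hμ.L_dual (N := 2 * n) (M := M) (⟨n, hn⟩, 0) (s := n) (k := 0) (by omega)
      (by omega)).trans (if_pos ⟨rfl, rfl⟩)
  constructor
  · intro h M hM j
    rw [← coeff_dual]
    exact ((h M _ hM.le).2 (hd M)).1 _ _ (Or.inl (by simpa using hM))
  · intro h
    have hdeg : ∀ M, m ≤ M → Deg (2 * n) M (d (M + 1)) := by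
      intro M hM k i hki
      rcases Nat.lt_or_ge (2 * n) i with hi | hi
      · exact deg_dual (2 * n) (M + 1) _ k i (Or.inr hi)
      · rcases Nat.lt_or_ge (M + 1) k with hk | hk
        · exact deg_dual (2 * n) (M + 1) _ k i (Or.inl hk)
        · obtain rfl : k = M + 1 := by omega
          exact (coeff_dual (2 * n) (M + 1) _ (⟨i, by omega⟩, Fin.last (M + 1))).trans
            (h (M + 1) (by omega) ⟨i, by omega⟩)
    have hd' : ∀ M, m ≤ M → MemH μ n M (d (M + 1)) := fun M hM =>
      ⟨hdeg M hM, fun s k hs hk hsk => (hd (M + 1)).2 s k hs (by omega) hsk⟩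
    intro M P hM
    induction M, hM using Nat.le_induction with
    | base => rfl
    | succ M hM ih =>
      rw [ih]
      constructor
      · intro hP
        rw [hμ.memH_eq_smul hP (hd' M hM) (hd1 _)]
        exact (hd (M + 1)).smul _
      · intro hP
        rw [hμ.memH_eq_smul hP (hd (M + 1)) (hd1 _)]
        exact (hd' M hM).smul _

end Matrix

end BernsteinSzego

/-! ### Reflection, and dual polynomials from the stability of `E²`. -/

namespace BernsteinSzego

open Polynomial ComplexConjugate

/-- The polynomial `z ^ N * conj (q (1 / conj z))`. -/
def rev (N : ℕ) (q : ℂ[X]) : ℂ[X] := reflect N (q.map (starRingEnd ℂ))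

theorem coeff_rev {N i : ℕ} (q : ℂ[X]) (hi : i ≤ N) :
    (rev N q).coeff i = conj (q.coeff (N - i)) := by
  rw [rev, coeff_reflect, revAt_le hi, coeff_map]

theorem natDegree_rev_le {N : ℕ} {q : ℂ[X]} (hq : q.natDegree ≤ N) : (rev N q).natDegree ≤ N := by
  refine natDegree_reflect_le.trans (max_le le_rfl ?_)
  exact natDegree_map_le.trans hq

theorem rev_rev (N : ℕ) (q : ℂ[X]) : rev N (rev N q) = q := by
  rw [rev, rev, ← reflect_map, reflect_reflect, Polynomial.map_map]
  simp

theorem rev_mul {N K : ℕ} {p q : ℂ[X]} (hp : p.natDegree ≤ N) (hq : q.natDegree ≤ K) :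
    rev (N + K) (p * q) = rev N p * rev K q := by
  rw [rev, Polynomial.map_mul, reflect_mul _ _ (natDegree_map_le.trans hp)
    (natDegree_map_le.trans hq)]
  rfl

theorem conj_eq_inv_of_norm {z : ℂ} (hz : ‖z‖ = 1) : conj z = z⁻¹ :=
  (Complex.inv_eq_conj hz).symm

theorem ne_zero_of_norm {z : ℂ} (hz : ‖z‖ = 1) : z ≠ 0 := by
  rintro rfl
  simp at hz

theorem eval_rev {N : ℕ} {q : ℂ[X]} (hq : q.natDegree ≤ N) {z : ℂ} (hz : ‖z‖ = 1) :
    (rev N q).eval z = z ^ N * conj (q.eval z) := by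
  have hz0 := ne_zero_of_norm hz
  rw [eval_eq_sum_range' (Nat.lt_succ_of_le (natDegree_rev_le hq)),
    eval_eq_sum_range' (Nat.lt_succ_of_le hq), ← Finset.sum_flip, map_sum, Finset.mul_sum]
  refine Finset.sum_congr rfl fun i hi => ?_
  have hi' : i ≤ N := by simpa [Nat.lt_succ_iff] using hi
  rw [coeff_rev q (Nat.sub_le N i), Nat.sub_sub_self hi', map_mul, map_pow, conj_eq_inv_of_norm hz,
    mul_left_comm, pow_sub₀ z hz0 hi', inv_pow]

/-- The polynomial with the values `z ^ N * w ^ M * conj (P (z, w))` on the torus. -/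
def revBi (N M : ℕ) (P : Bi) : Bi :=
  ofCoeff N M fun i k => conj ((P.coeff (M - k)).coeff (N - i))

theorem deg_revBi (N M : ℕ) (P : Bi) : Deg N M (revBi N M P) := deg_ofCoeff N M _

theorem ev_revBi {N M : ℕ} {P : Bi} (hP : Deg N M P) (x : Torus) :
    ev (revBi N M P) x = conj (ev P x) * chi N M x := by
  rw [(deg_revBi N M P).ev_eq, hP.ev_eq, ← Finset.sum_flip, map_sum, Finset.sum_mul]
  refine Finset.sum_congr rfl fun k hk => ?_
  rw [← Finset.sum_flip, map_sum, Finset.sum_mul]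
  refine Finset.sum_congr rfl fun i hi => ?_
  have hk' : k ≤ M := by simpa [Nat.lt_succ_iff] using hk
  have hi' : i ≤ N := by simpa [Nat.lt_succ_iff] using hi
  rw [revBi, coeff_ofCoeff, if_pos ⟨Nat.sub_le _ _, Nat.sub_le _ _⟩, Nat.sub_sub_self hk',
    Nat.sub_sub_self hi', map_mul, conj_chi, mul_assoc, chi_mul_chi]
  congr 2 <;> omega

theorem L_revBi {μ : Measure Torus} [IsFiniteMeasure μ] {N M : ℕ} {P : Bi} (hP : Deg N M P)
    (s k : ℤ) : L μ (revBi N M P) s k = conj (L μ P (N - s) (M - k)) := by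
  have h : ev (revBi N M P) = fun x => conj (ev P x) * chi N M x := funext fun x => ev_revBi hP x
  rw [L, h, fc_mul_chi, fc_conj, L, neg_sub, neg_sub]

/-- The polynomials `z ^ n * e_t` with `e_t` dual to the monomials `z ^ s * w ^ k`, `s ∈ ℤ`,
`k ≤ M`, exist in `P_{2n,M}`. -/
def HasDual (μ : Measure Torus) (n M : ℕ) : Prop :=
  ∀ t ≤ M, ∃ P, Deg (2 * n) M P ∧
    ∀ (s : ℤ) (k : ℕ), k ≤ M → L μ P s k = if s = n ∧ k = t then 1 else 0

variable {μ : Measure Torus} [IsFiniteMeasure μ]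

/-- Induction on `i`, with `EStable` as the case `i = 0`. Subtracting a suitable `z f` puts `P` into
`E²`, and the inner products of `f` are those of `P` shifted by one in `z`, so `f` falls under the
previous case. -/
theorem EStable.L_eq_zero {n M : ℕ} (hE : EStable μ n M) (hμ : NonDegenerate μ) (i : ℕ) :
    ∀ {N : ℕ} {P : Bi}, Deg N M P → n + i ≤ N →
      (∀ s k : ℕ, i < s → s ≤ N → k ≤ M → L μ P s k = 0) →
      ∀ s k : ℕ, i < s → k ≤ M → L μ P s k = 0 := by
  induction i with
  | zero =>
    intro N P hP hN h s k hs hk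
    exact (hE N P hN ⟨hP, h⟩).2 s k hs hk
  | succ i ih =>
    intro N P hP hN h s k hs hk
    obtain ⟨N, rfl⟩ : ∃ N', N = N' + 1 := ⟨N - 1, by omega⟩
    obtain ⟨f, hf, hfL⟩ := hμ.exists_L N M fun s k => L μ P ((s + 1 : ℕ) : ℤ) k
    have hXf : ∀ s k : ℕ, 1 ≤ s → L μ (C X * f) s k = L μ f ((s - 1 : ℕ) : ℤ) k := by
      intro s k hs
      rw [L_C_X_mul, Nat.cast_sub hs, Nat.cast_one]
    have hsub : MemE μ (N + 1) M (P - C X * f) := by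
      refine ⟨hP.sub ((hf.C_mul natDegree_X_le).mono (by omega) le_rfl), fun s k h1 hs hk => ?_⟩
      rw [L_sub, hXf s k h1, hfL _ _ (by omega) hk, Nat.sub_add_cancel h1, sub_self]
    have h1 := (hE (N + 1) _ (by omega) hsub).2 s k (by omega) hk
    rw [L_sub, hXf s k (by omega), sub_eq_zero] at h1
    rw [h1]
    refine ih hf (by omega) (fun s k hs hsN hk => ?_) _ k (by omega) hk
    rw [hfL s k hsN hk]
    exact h _ _ (by omega) (by omega) hk

/-- The dual of `z^n w^t` within `P_{2n,M}` is already orthogonal to `z^s w^k` for `n < s ≤ 2n`, so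
`EStable.L_eq_zero` extends this to all `s > n`. Negative `s` follow by reflection, which fixes the
central exponent `n`. -/
theorem EStable.hasDual {n M : ℕ} (hE : EStable μ n M) (hμ : NonDegenerate μ) :
    HasDual μ n M := by
  choose d hd hdL using fun t : ℕ => hμ.exists_L (2 * n) M
    fun s k => if s = n ∧ k = t then 1 else 0
  have hup : ∀ t, ∀ s k : ℕ, n < s → k ≤ M → L μ (d t) s k = 0 := fun t =>
    hE.L_eq_zero hμ n (hd t) (by omega) fun s k hs hsN hk => by
      rw [hdL t s k hsN hk, if_neg (by omega)]
  -- Reflection sends `(s,k)` to `(2n-s, M-k)`, so the reflected polynomial has the inner products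
  -- of the dual of `z^n w^{M-t}`.
  have hrev : ∀ t ≤ M, revBi (2 * n) M (d t) = d (M - t) := by
    intro t ht
    refine hμ.eq_of_L (deg_revBi _ _ _) (hd _) fun i l hi hl => ?_
    rw [L_revBi (hd t), ← Nat.cast_sub hi, ← Nat.cast_sub hl, hdL _ _ _ (Nat.sub_le _ _)
      (Nat.sub_le _ _), hdL _ _ _ hi hl, apply_ite conj, map_one, map_zero]
    exact if_congr (by omega) rfl rfl
  intro t ht
  refine ⟨d t, hd t, fun s k hk => ?_⟩
  rcases lt_or_ge s 0 with hs | hs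
  · rw [if_neg (by omega)]
    have h := L_revBi (μ := μ) (hd t) ((2 * n : ℕ) - s) ((M : ℤ) - k)
    rw [hrev t ht, sub_sub_cancel, sub_sub_cancel] at h
    have h0 := hup (M - t) (2 * n + s.natAbs) (M - k) (by omega) (Nat.sub_le _ _)
    rw [show (((2 * n + s.natAbs : ℕ) : ℤ)) = ((2 * n : ℕ) : ℤ) - s by omega, Nat.cast_sub hk, h]
      at h0
    simpa using h0
  · lift s to ℕ using hs
    rcases Nat.lt_or_ge (2 * n) s with h | h
    · rw [hup t s k (by omega) hk, if_neg (by omega)]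
    · rw [hdL t s k h hk]
      exact if_congr (by omega) rfl rfl

/-- Coefficients of the dual polynomials in terms of inner products. -/
theorem fc_mul_conj_dual {n N M t : ℕ} {d : Bi} (hd : Deg N M d)
    {M' : ℕ} {P : Bi} (hPL : ∀ (s : ℤ) (k : ℕ), k ≤ M' → L μ P s k = if s = n ∧ k = t then 1 else 0)
    {k : ℕ} (hk : k + M ≤ M') (s : ℤ) (i : ℕ) (hi : s + i = n) :
    fc μ (fun x => ev P x * conj (ev d x)) s k =
      if k ≤ t then conj ((d.coeff (t - k)).coeff i) else 0 := by
  rw [fc_ev_mul_conj_ev P hd]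
  have h1 : ∀ l ∈ Finset.range (M + 1), ∀ j ∈ Finset.range (N + 1),
      conj ((d.coeff l).coeff j) * L μ P (s + j) (k + l) =
        if j = i then (if k + l = t then conj ((d.coeff l).coeff j) else 0) else 0 := by
    intro l hl j hj
    have hl' : k + l ≤ M' := by simp at hl; omega
    have := hPL (s + j) (k + l) hl'
    rw [Nat.cast_add] at this
    rw [this]
    by_cases h : j = i
    · by_cases h' : k + l = t
      · rw [if_pos ⟨by omega, h'⟩, if_pos h, if_pos h', mul_one]
      · rw [if_neg (by omega), if_pos h, if_neg h', mul_zero]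
    · rw [if_neg (by omega), if_neg h, mul_zero]
  rw [Finset.sum_congr rfl fun l hl => Finset.sum_congr rfl fun j hj => h1 l hl j hj]
  simp only [Finset.sum_ite_eq']
  by_cases hi2 : i ∈ Finset.range (N + 1)
  · simp only [hi2, if_true]
    by_cases hkt : k ≤ t
    · rw [if_pos hkt]
      simp only [show ∀ l, k + l = t ↔ l = t - k by omega, Finset.sum_ite_eq']
      split_ifs with h
      · rfl
      · rw [hd (t - k) i (Or.inl (by simp at h; omega)), map_zero]
    · rw [if_neg hkt]
      exact Finset.sum_eq_zero fun l _ => if_neg (by omega)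
  · simp only [hi2, if_false, Finset.sum_const_zero]
    split_ifs
    · rw [hd (t - k) i (Or.inr (by simp at hi2; omega)), map_zero]
    · rfl

/-- Both coefficients are, up to conjugation, the Fourier coefficient of `P conj(Q) dμ` at
`z^{i-n}`: the inverse of a Hermitian matrix is Hermitian. -/
theorem coeff_dual_hermitian {n M t l : ℕ} {P Q : Bi} (hP : Deg (2 * n) M P)
    (hQ : Deg (2 * n) M Q)
    (hPL : ∀ (s : ℤ) (k : ℕ), k ≤ M → L μ P s k = if s = n ∧ k = t then 1 else 0)
    (hQL : ∀ (s : ℤ) (k : ℕ), k ≤ M → L μ Q s k = if s = n ∧ k = l then 1 else 0) :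
    P.coeff l = rev (2 * n) (Q.coeff t) := by
  ext i
  rcases Nat.lt_or_ge (2 * n) i with hi | hi
  · rw [hP l i (Or.inr hi), coeff_eq_zero_of_natDegree_lt]
    exact (natDegree_rev_le (hQ.natDegree_coeff_le t)).trans_lt hi
  · rw [coeff_rev _ hi]
    have h1 := fc_mul_conj_dual hQ hPL (k := 0) (by omega) (i - n : ℤ) (2 * n - i)
      (by omega)
    have h2 := fc_mul_conj_dual hP hQL (k := 0) (by omega) (-(i - n : ℤ)) i (by omega)
    simp only [zero_le, if_true, Nat.sub_zero] at h1 h2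
    have h3 := fc_conj (μ := μ) (F := fun x => ev P x * conj (ev Q x)) (-(i - n : ℤ)) 0
    simp only [map_mul, Complex.conj_conj, neg_neg, neg_zero] at h3
    rw [← h1, ← Complex.conj_conj ((P.coeff l).coeff i), ← h2, Nat.cast_zero, ← Complex.conj_conj
      (fc μ (fun x => ev P x * conj (ev Q x)) _ _), ← h3]
    simp only [mul_comm]

end BernsteinSzego

/-! ### The kernel polynomial `d` and its divisibility property. -/

namespace BernsteinSzego

open Polynomial ComplexConjugate

/-- The common element `d` of the spaces `H_M`: as a function of `z` and `w` it is the value at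
`0` of the reproducing kernel, up to the factor `z ^ n`. -/
theorem exists_kernel {μ : Measure Torus} [IsFiniteMeasure μ] (hμ : NonDegenerate μ) {n m : ℕ}
    (hE : ∀ M, m ≤ M + 1 → EStable μ n M) (hH : HStable μ n m) :
    ∃ d : Bi, Deg (2 * n) m d ∧
      (∀ (s : ℤ) (k : ℕ), L μ d s k = if s = n ∧ k = 0 then 1 else 0) ∧
      rev (2 * n) (d.coeff 0) = d.coeff 0 ∧
      ∀ a b, d.coeff 0 ∣ d.coeff a * rev (2 * n) (d.coeff b) := by
  have hD : ∀ M, m ≤ M + 1 → HasDual μ n M := fun M hM => (hE M hM).hasDual hμ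
  have hmem : ∀ (M : ℕ) (d : Bi), Deg (2 * n) M d → (∀ (s : ℤ) (k : ℕ), k ≤ M →
      L μ d s k = if s = n ∧ k = 0 then 1 else 0) → MemH μ n M d := fun M d h h' =>
    ⟨h, fun s k _ hk hsk => by
      rw [h' s k hk, if_neg]
      simpa using hsk⟩
  obtain ⟨d, hd, hdL⟩ := hD m (by omega) 0 (by omega)
  -- For larger `M` the dual `e` of `z^n` lies on the line `H_M`, which equals `H_m` and contains
  -- `d`; the normalization gives `d = e`.
  have hL : ∀ (s : ℤ) (k : ℕ), L μ d s k = if s = n ∧ k = 0 then 1 else 0 := by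
    intro s k
    obtain ⟨e, he, heL⟩ := hD (max m k) (by omega) 0 (by omega)
    have h1 : d = L μ d n 0 • e := hμ.memH_eq_smul
      ((hH _ d (le_max_left m k)).1 (hmem m d hd hdL)) (hmem _ e he heL)
      ((heL n 0 (Nat.zero_le _)).trans (by simp))
    have h2 := hdL n 0 (Nat.zero_le _)
    rw [Nat.cast_zero] at h2
    rw [h2] at h1
    simp only [true_and, if_true, one_smul] at h1
    rw [h1]
    exact heL s k (le_max_right m k)
  have hrev : d.coeff 0 = rev (2 * n) (d.coeff 0) := coeff_dual_hermitian hd hd hdL hdL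
  refine ⟨d, hd, hL, hrev.symm, fun a b => ?_⟩
  rcases Nat.lt_or_ge m b with hb | hb
  · rw [hd.coeff_eq_zero hb]
    simp [rev]
  rcases Nat.eq_zero_or_pos b with rfl | hb0
  · rw [← hrev]
    exact Dvd.intro_left _ rfl
  obtain ⟨e, he, heL⟩ := hD m (by omega) b hb
  -- Here `1 ≤ b ≤ m`, so the level `m - 1` is a genuine one; this is where stability of `E²` at `M
  -- = m - 1` enters.
  obtain ⟨e', he', heL'⟩ := hD (m - 1) (by omega) (b - 1) (by omega)
  have hcoeff : e.coeff 0 = rev (2 * n) (d.coeff b) := coeff_dual_hermitian he hd heL hdL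
  have hXe' : Deg (2 * n) m (X * e') := by
    have := (deg_X_pow 1).mul he'
    rw [pow_one] at this
    exact this.mono (by omega) (by omega)
  -- The coefficient at `w^0` cancels because that of `e` is the reflection of `d.coeff b`. For `1 ≤
  -- l ≤ m` the inner products of `e` and `w e'` with `z^s w^l` agree, and those of `d` vanish. The
  -- polynomial is therefore orthogonal to its own support. Comparing coefficients at `w^a` gives
  -- the divisibility.
  have hu : C (d.coeff 0) * (e - X * e') - C (rev (2 * n) (d.coeff b)) * d = 0 := by
    refine hμ.eq_zero (((he.sub hXe').C_mul (hd.natDegree_coeff_le 0)).sub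
      (hd.C_mul (natDegree_rev_le (hd.natDegree_coeff_le b)))) fun l i hli => ?_
    have hl0 : l ≠ 0 := by
      rintro rfl
      refine hli ?_
      simp [hcoeff, mul_comm]
    have hlm : l ≤ m := by
      by_contra hl
      refine hli ?_
      rw [coeff_sub, coeff_C_mul, coeff_C_mul, (he.sub hXe').coeff_eq_zero (not_le.1 hl),
        hd.coeff_eq_zero (not_le.1 hl)]
      simp
    rw [L_sub, L_C_mul, L_C_mul, Finset.sum_eq_zero, Finset.sum_eq_zero, sub_zero]
    · intro j _
      rw [hL, if_neg (by omega), mul_zero]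
    · intro j _
      have := heL' (i - j) (l - 1) (by omega)
      rw [Nat.cast_sub (by omega), Nat.cast_one] at this
      rw [L_sub, L_X_mul, this, heL _ _ hlm, sub_eq_zero.2, mul_zero]
      exact if_congr (by omega) rfl rfl
  have ha := congrArg (fun P : Bi => P.coeff a) hu
  simp only [coeff_sub, coeff_C_mul, coeff_zero] at ha
  rw [mul_comm (d.coeff a), ← sub_eq_zero.1 ha]
  exact Dvd.intro _ rfl

end BernsteinSzego

/-! ### A rank one Fejér–Riesz theorem. -/

namespace BernsteinSzego

open Polynomial ComplexConjugate

theorem rev_X_sub_C (α : ℂ) : rev 1 (X - C α) = 1 - C (conj α) * X := by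
  rw [rev, Polynomial.map_sub, map_X, map_C, reflect_sub, reflect_one_X, reflect_C, pow_one]

theorem eval_X_sub_C_mul_rev (α : ℂ) {z : ℂ} (hz : ‖z‖ = 1) :
    ((X - C α) * (1 - C (conj α) * X)).eval z = z * ((‖z - α‖ ^ 2 : ℝ) : ℂ) := by
  have h := eval_rev (natDegree_X_sub_C_le α) hz
  rw [rev_X_sub_C] at h
  rw [eval_mul, h, eval_sub, eval_X, eval_C, pow_one, mul_left_comm, Complex.mul_conj']
  push_cast
  rfl

/-- A rank one version of the Fejér–Riesz theorem: if the entries of the matrix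
`(V_a conj V_b z ^ δ / S)` are trigonometric polynomials of degree at most `n`, then the matrix is
`(p_a conj p_b)` for some polynomials `p_a` of degree at most `n`. -/
theorem exists_factorization {ι : Type*} (n δ : ℕ) : ∀ (S : ℂ[X]) (V : ι → ℂ[X]),
    S.natDegree ≤ 2 * δ → rev (2 * δ) S = S →
    (∀ z : ℂ, ‖z‖ = 1 → ∃ r : ℝ, 0 < r ∧ S.eval z = z ^ δ * r) →
    (∀ a, (V a).natDegree ≤ n + δ) → (∀ a b, S ∣ V a * rev (n + δ) (V b)) →
    ∃ p : ι → ℂ[X], (∀ a, (p a).natDegree ≤ n) ∧ ∀ z : ℂ, ‖z‖ = 1 → ∀ a b,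
      (V a).eval z * conj ((V b).eval z) * z ^ δ =
        (p a).eval z * conj ((p b).eval z) * S.eval z := by
  induction δ with
  | zero =>
    intro S V hS _ hpos hV _
    obtain ⟨c, rfl⟩ : ∃ c, S = C c := ⟨_, eq_C_of_natDegree_le_zero hS⟩
    obtain ⟨r, hr, hc⟩ := hpos 1 (by simp)
    rw [eval_C, pow_zero, one_mul] at hc
    subst hc
    have hs : ((Real.sqrt r : ℝ) : ℂ) ^ 2 = r := by exact_mod_cast Real.sq_sqrt hr.le
    have hs0 : ((Real.sqrt r : ℝ) : ℂ) ≠ 0 := by exact_mod_cast (Real.sqrt_pos.2 hr).ne'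
    refine ⟨fun a => C ((Real.sqrt r : ℝ) : ℂ)⁻¹ * V a, fun a =>
      (natDegree_C_mul_le _ _).trans (hV a), fun z _ a b => ?_⟩
    simp only [eval_mul, eval_C, map_mul, map_inv₀, Complex.conj_ofReal, pow_zero, mul_one]
    rw [← hs]
    field_simp
  | succ δ ih =>
    intro S V hS hrev hpos hV hdvd
    -- If `S` were constant, its constant term would be the conjugate of the coefficient at `2(δ+1)
    -- > 0`, hence zero, against positivity.
    have hdeg : 0 < S.degree := by
      by_contra h
      have hc := eq_C_of_degree_le_zero (not_lt.1 h)
      have h0 : S.coeff 0 = 0 := by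
        rw [← hrev, coeff_rev S (Nat.zero_le _), hc, coeff_C_of_ne_zero (by omega), map_zero]
      obtain ⟨r, hr, h1⟩ := hpos 1 (by simp)
      rw [hc, h0] at h1
      simp at h1
      exact hr.ne (by exact_mod_cast h1)
    obtain ⟨α, hα⟩ := Complex.exists_root hdeg
    have hα1 : ‖α‖ ≠ 1 := by
      intro h
      obtain ⟨r, hr, h1⟩ := hpos α h
      rw [hα.eq_zero] at h1
      have := mul_ne_zero (pow_ne_zero (δ + 1) (ne_zero_of_norm h)) (Complex.ofReal_ne_zero.2 hr.ne')
      exact this h1.symm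
    -- The self-reflected factor belonging to the root `α`. Its formal degree is 2 even for `α = 0`,
    -- where the partner root lies at infinity. It divides `S` because `|α| ≠ 1`.
    set B : ℂ[X] := (X - C α) * (1 - C (conj α) * X) with hB
    have hX1 : (1 - C (conj α) * X : ℂ[X]).natDegree ≤ 1 := by
      rw [← rev_X_sub_C]
      exact natDegree_rev_le (natDegree_X_sub_C_le α)
    have hX0 : (1 - C (conj α) * X : ℂ[X]) ≠ 0 := by
      intro h
      have := congrArg (fun p => p.coeff 0) h
      simp at this
    have hB0 : B ≠ 0 := mul_ne_zero (X_sub_C_ne_zero α) hX0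
    have hrev1 : rev 1 (1 - C (conj α) * X) = X - C α := by rw [← rev_X_sub_C, rev_rev]
    have hBrev : rev 2 B = B := by
      rw [hB, show 2 = 1 + 1 from rfl, rev_mul (natDegree_X_sub_C_le α) hX1, hrev1, rev_X_sub_C,
        mul_comm]
    have hdiv : ∀ {K : ℕ} {p : ℂ[X]}, p.natDegree ≤ K + 1 → p.eval α = 0 →
        ∃ q : ℂ[X], q.natDegree ≤ K ∧ p = (X - C α) * q := by
      intro K p hp h
      obtain ⟨q, rfl⟩ := dvd_iff_isRoot.2 h
      refine ⟨q, ?_, rfl⟩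
      by_cases hq : q = 0
      · simp [hq]
      · rw [natDegree_mul (X_sub_C_ne_zero α) hq, natDegree_X_sub_C] at hp
        omega
    obtain ⟨S1, hS1, hSS1⟩ := hdiv (K := 2 * δ + 1) hS hα
    have h2 : S = (1 - C (conj α) * X) * rev (2 * δ + 1) S1 := by
      rw [← hrev, hSS1, show 2 * (δ + 1) = 1 + (2 * δ + 1) by ring,
        rev_mul (natDegree_X_sub_C_le α) hS1, rev_X_sub_C]
    obtain ⟨S2, hS2, hS12⟩ := hdiv (K := 2 * δ) (natDegree_rev_le hS1) (by
      have h := hα.eq_zero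
      rw [h2, eval_mul] at h
      refine (mul_eq_zero.1 h).resolve_left fun h => hα1 ?_
      simp only [eval_sub, eval_one, eval_mul, eval_C, eval_X, mul_comm (conj α),
        Complex.mul_conj'] at h
      have h' : ‖α‖ ^ 2 = 1 := by exact_mod_cast (sub_eq_zero.1 h).symm
      exact (pow_eq_one_iff_of_nonneg (norm_nonneg _) two_ne_zero).1 h')
    have hSB : S = B * S2 := by rw [h2, hS12, hB]; ring
    have hS2rev : rev (2 * δ) S2 = S2 := by
      have h : B * rev (2 * δ) S2 = B * S2 := by
        rw [← hSB, ← hrev, hSB, show 2 * (δ + 1) = 2 + 2 * δ by ring, rev_mul _ hS2, hBrev]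
        rw [hB]
        exact natDegree_mul_le_of_le (natDegree_X_sub_C_le α) hX1
      exact mul_left_cancel₀ hB0 h
    have hBz : ∀ z : ℂ, ‖z‖ = 1 → B.eval z = z * ((‖z - α‖ ^ 2 : ℝ) : ℂ) := fun z hz =>
      eval_X_sub_C_mul_rev α hz
    have hpos2 : ∀ z : ℂ, ‖z‖ = 1 → ∃ r : ℝ, 0 < r ∧ S2.eval z = z ^ δ * r := by
      intro z hz
      obtain ⟨r, hr, h⟩ := hpos z hz
      have hzα : 0 < ‖z - α‖ := norm_pos_iff.2 (sub_ne_zero.2 fun h => hα1 (h ▸ hz))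
      refine ⟨r / ‖z - α‖ ^ 2, by positivity, ?_⟩
      rw [hSB, eval_mul, hBz z hz] at h
      have hz0 := ne_zero_of_norm hz
      have h0 : ((‖z - α‖ : ℝ) : ℂ) ≠ 0 := by exact_mod_cast hzα.ne'
      push_cast at h ⊢
      field_simp
      refine mul_left_cancel₀ hz0 ?_
      linear_combination h
    obtain ⟨W, hW, hVW⟩ : ∃ W : ι → ℂ[X], (∀ a, (W a).natDegree ≤ n + δ) ∧
        ∀ a b, V a * rev (n + (δ + 1)) (V b) = B * (W a * rev (n + δ) (W b)) := by
      -- The rank one structure: all products of a `V a` with a reflected `V b` vanish at `α`, so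
      -- one of the two families vanishes there entirely. Hence one linear factor can be removed
      -- from all the `V a` at once.
      have hcases : (∀ a, (V a).eval α = 0) ∨ ∀ b, (rev (n + (δ + 1)) (V b)).eval α = 0 := by
        by_contra! h
        obtain ⟨⟨a, ha⟩, b, hb⟩ := h
        obtain ⟨q, hq⟩ := hdvd a b
        have := congrArg (eval α) hq
        rw [eval_mul, eval_mul, hα.eq_zero, zero_mul] at this
        exact mul_ne_zero ha hb this
      have hadd : n + (δ + 1) = 1 + (n + δ) := by ring
      rcases hcases with h | h
      · choose W hW hVW using fun a => hdiv (K := n + δ) (hV a) (h a)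
        refine ⟨W, hW, fun a b => ?_⟩
        rw [hVW a, hVW b, hadd, rev_mul (natDegree_X_sub_C_le α) (hW b), rev_X_sub_C, hB]
        ring
      · choose Y hY hVY using fun b => hdiv (K := n + δ)
          (p := rev (n + (δ + 1)) (V b)) (natDegree_rev_le (hV b)) (h b)
        refine ⟨fun a => rev (n + δ) (Y a), fun a => natDegree_rev_le (hY a), fun a b => ?_⟩
        rw [hVY b, ← rev_rev (n + (δ + 1)) (V a), hVY a, hadd,
          rev_mul (natDegree_X_sub_C_le α) (hY a), rev_X_sub_C, rev_rev, hB]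
        ring
    obtain ⟨p, hp, hpW⟩ := ih S2 W hS2 hS2rev hpos2 hW fun a b => by
      have h := hdvd a b
      rw [hVW, hSB] at h
      exact (mul_dvd_mul_iff_left hB0).1 h
    refine ⟨p, hp, fun z hz a b => ?_⟩
    have h := congrArg (eval z) (hVW a b)
    rw [eval_mul, eval_mul (p := B), eval_mul (p := W a), eval_rev (hV b) hz,
      eval_rev (hW b) hz] at h
    rw [hSB, eval_mul]
    have hz0 := ne_zero_of_norm hz
    refine mul_left_cancel₀ (pow_ne_zero n hz0) ?_
    linear_combination h + z ^ n * B.eval z * hpW z hz a b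

end BernsteinSzego

/-! ### Lebesgue measure on the torus, Cauchy's formula, uniqueness of moments. -/

namespace BernsteinSzego

open Polynomial ComplexConjugate BoundedContinuousFunction

theorem arcLength_univ : arcLength Set.univ = 1 := by
  have hmeas : Measurable (Circle.exp : ℝ → Circle) := Circle.exp.continuous.measurable
  have h0 : ENNReal.ofReal (2 * Real.pi) ≠ 0 := by
    rw [ne_eq, ENNReal.ofReal_eq_zero, not_le]
    positivity
  rw [arcLength, Measure.smul_apply, Measure.map_apply hmeas MeasurableSet.univ, Set.preimage_univ,
    Measure.restrict_apply_univ, Real.volume_Ioc, smul_eq_mul,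
    show Real.pi - -Real.pi = 2 * Real.pi by ring]
  exact ENNReal.inv_mul_cancel h0 ENNReal.ofReal_ne_top

instance : IsProbabilityMeasure arcLength := ⟨arcLength_univ⟩

instance : IsProbabilityMeasure sigma := by unfold sigma; infer_instance

theorem integral_arcLength (F : ℂ → ℂ) (hF : Continuous fun w : Circle => F w) :
    ∫ w : Circle, F w ∂arcLength = Real.circleAverage F 0 1 := by
  have hmeas : Measurable (Circle.exp : ℝ → Circle) := Circle.exp.continuous.measurable
  rw [arcLength, integral_smul_measure, integral_map hmeas.aemeasurable
    hF.aestronglyMeasurable, Real.circleAverage_eq_integral_add (-Real.pi),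
    intervalIntegral.integral_comp_add_right (fun θ => F (circleMap 0 1 θ)),
    intervalIntegral.integral_of_le (by linarith [Real.pi_pos]), ENNReal.toReal_inv,
    ENNReal.toReal_ofReal (by positivity)]
  congr 2
  · congr 2 <;> ring
  · funext θ
    simp [circleMap]

theorem integral_arcLength_of_diffContOnCl {F : ℂ → ℂ} (hF : DiffContOnCl ℂ F (Metric.ball 0 1)) :
    ∫ w : Circle, F w ∂arcLength = F 0 := by
  rw [integral_arcLength]
  · exact DiffContOnCl.circleAverage (by simpa using hF)
  · have h := hF.continuousOn
    rw [closure_ball _ one_ne_zero] at h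
    exact h.comp_continuous continuous_subtype_val fun w =>
      mem_closedBall_zero_iff.2 (Circle.norm_coe w).le

theorem integral_arcLength_zpow (k : ℤ) :
    ∫ w : Circle, (w : ℂ) ^ k ∂arcLength = if k = 0 then 1 else 0 := by
  have hpow : ∀ j : ℕ, ∫ w : Circle, (w : ℂ) ^ j ∂arcLength = if j = 0 then 1 else 0 := by
    intro j
    have := integral_arcLength_of_diffContOnCl (F := fun w => w ^ j)
      (differentiable_pow j).diffContOnCl
    rw [this, zero_pow_eq]
  obtain ⟨j, rfl | rfl⟩ := k.eq_nat_or_neg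
  · simpa using hpow j
  · have h : ∀ w : Circle, (w : ℂ) ^ (-(j : ℤ)) = conj ((w : ℂ) ^ j) := fun w => by
      rw [map_pow, ← Circle.coe_inv_eq_conj, Circle.coe_inv, zpow_neg, zpow_natCast, inv_pow]
    simp only [h]
    rw [integral_conj, hpow]
    simp [apply_ite]

theorem integral_chi_sigma (s k : ℤ) :
    ∫ x, chi s k x ∂sigma = if s = 0 ∧ k = 0 then 1 else 0 := by
  simp only [chi, sigma]
  rw [integral_prod_mul (fun z : Circle => (z : ℂ) ^ s) (fun w : Circle => (w : ℂ) ^ k),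
    integral_arcLength_zpow, integral_arcLength_zpow]
  by_cases hs : s = 0 <;> by_cases hk : k = 0 <;> simp [hs, hk]

theorem fc_one_sigma (s k : ℤ) :
    fc sigma (fun _ => 1) s k = if s = 0 ∧ k = 0 then 1 else 0 := by
  simp only [fc, one_mul, integral_chi_sigma, neg_eq_zero]

/-- Cauchy's formula in the variable `w`, integrated over `z`. -/
theorem integral_sigma_of_diffContOnCl (G : ℂ → ℂ → ℂ)
    (hG : Continuous fun x : Torus => G x.1 x.2)
    (hd : ∀ z : ℂ, ‖z‖ = 1 → DiffContOnCl ℂ (G z) (Metric.ball 0 1)) :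
    ∫ x, G x.1 x.2 ∂sigma = ∫ z : Circle, G z 0 ∂arcLength := by
  rw [sigma, integral_prod _ (integrable_torus hG sigma)]
  exact integral_congr_ae (Filter.Eventually.of_forall fun z =>
    integral_arcLength_of_diffContOnCl (hd z (Circle.norm_coe z)))

/-- The characters as bounded continuous functions. -/
def chiB (u : ℤ × ℤ) : Torus →ᵇ ℂ := BoundedContinuousFunction.mkOfCompact ⟨_, continuous_chi u.1 u.2⟩

theorem chiB_apply (u : ℤ × ℤ) (x : Torus) : chiB u x = chi u.1 u.2 x := rfl

/-- The trigonometric polynomials. -/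
def trigPoly : StarSubalgebra ℂ (Torus →ᵇ ℂ) where
  carrier := Submodule.span ℂ (Set.range chiB)
  mul_mem' := by
    intro a b ha hb
    have h : Submodule.span ℂ (Set.range chiB) * Submodule.span ℂ (Set.range chiB) ≤
        Submodule.span ℂ (Set.range chiB) := by
      rw [Submodule.span_mul_span]
      refine Submodule.span_mono ?_
      rintro _ ⟨_, ⟨u, rfl⟩, _, ⟨v, rfl⟩, rfl⟩
      refine ⟨u + v, ?_⟩
      ext x
      exact (chi_mul_chi _ _ _ _ x).symm
    exact h (Submodule.mul_mem_mul ha hb)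
  add_mem' := Submodule.add_mem _
  algebraMap_mem' := by
    intro c
    have : algebraMap ℂ (Torus →ᵇ ℂ) c = c • chiB 0 := by
      ext x
      simp [chiB_apply, Algebra.algebraMap_eq_smul_one]
    rw [this]
    exact Submodule.smul_mem _ _ (Submodule.subset_span ⟨0, rfl⟩)
  star_mem' := by
    intro a ha
    induction ha using Submodule.span_induction with
    | mem x hx =>
      obtain ⟨u, rfl⟩ := hx
      refine Submodule.subset_span ⟨-u, ?_⟩
      ext x
      exact (conj_chi _ _ x).symm
    | zero => simp
    | add a b _ _ ha hb =>
      rw [star_add]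
      exact Submodule.add_mem _ ha hb
    | smul c a _ ha =>
      rw [star_smul]
      exact Submodule.smul_mem _ _ ha

theorem trigPoly_separatesPoints :
    (trigPoly.map (toContinuousMapStarₐ ℂ)).SeparatesPoints := by
  intro x y hxy
  have hmem : ∀ u : ℤ × ℤ, (fun x => chi u.1 u.2 x) ∈ (fun f : C(Torus, ℂ) => (f : Torus → ℂ)) ''
      (trigPoly.map (toContinuousMapStarₐ ℂ) : Set C(Torus, ℂ)) := fun u =>
    ⟨_, ⟨chiB u, Submodule.subset_span ⟨u, rfl⟩, rfl⟩, rfl⟩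
  by_cases h1 : x.1 = y.1
  · refine ⟨_, hmem (0, 1), ?_⟩
    have h2 : x.2 ≠ y.2 := fun h2 => hxy (Prod.ext h1 h2)
    exact fun h => h2 (Circle.ext (by simpa [chi] using h))
  · refine ⟨_, hmem (1, 0), ?_⟩
    exact fun h => h1 (Circle.ext (by simpa [chi] using h))

/-- A finite measure on the torus is determined by its moments. -/
theorem ext_of_fc_eq {μ ν : Measure Torus} [IsFiniteMeasure μ] [IsFiniteMeasure ν]
    (h : ∀ s k, fc μ (fun _ => 1) s k = fc ν (fun _ => 1) s k) : μ = ν := by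
  refine ext_of_forall_mem_subalgebra_integral_eq_of_pseudoEMetric_complete_countable
    trigPoly_separatesPoints fun g hg => ?_
  have hg' : g ∈ Submodule.span ℂ (Set.range chiB) := hg
  induction hg' using Submodule.span_induction with
  | mem x hx =>
    obtain ⟨u, rfl⟩ := hx
    have := h (-u.1) (-u.2)
    simpa [fc, chiB_apply] using this
  | zero => simp
  | add a b ha' hb' ha hb =>
    simp only [BoundedContinuousFunction.coe_add, Pi.add_apply]
    rw [integral_add (a.integrable μ) (b.integrable μ), integral_add (a.integrable ν)
      (b.integrable ν), ha ha', hb hb']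
  | smul c a ha' ha =>
    simp only [BoundedContinuousFunction.coe_smul, integral_smul, ha ha']

end BernsteinSzego

/-! ### The Dirichlet kernel and Fejér sums. -/

namespace BernsteinSzego

open Polynomial ComplexConjugate Filter Topology

/-- The Dirichlet kernel in the variable `z`, centered at `z₀`. -/
def dk (z₀ : Circle) (N : ℕ) (x : Torus) : ℂ := ∑ j ∈ Finset.range N, (z₀ : ℂ) ^ (-j : ℤ) * chi j 0 x

@[fun_prop] theorem continuous_dk (z₀ : Circle) (N : ℕ) : Continuous (dk z₀ N) := by
  unfold dk
  fun_prop

theorem norm_dk_le (z₀ : Circle) (N : ℕ) (x : Torus) : ‖dk z₀ N x‖ ≤ N := by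
  refine (norm_sum_le _ _).trans ?_
  simp only [norm_mul, norm_zpow, Circle.norm_coe, one_zpow, norm_chi, mul_one, Finset.sum_const,
    Finset.card_range, nsmul_eq_mul, le_refl]

/-- The geometric sum telescopes to `(x.1 / z₀)^N - 1`. -/
theorem norm_dk_mul_le (z₀ : Circle) (N : ℕ) (x : Torus) :
    ‖dk z₀ N x‖ * ‖(x.1 : ℂ) - z₀‖ ≤ 2 := by
  have hz : (z₀ : ℂ) ≠ 0 := Circle.coe_ne_zero _
  have h1 : dk z₀ N x = ∑ j ∈ Finset.range N, ((x.1 : ℂ) / z₀) ^ j := by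
    refine Finset.sum_congr rfl fun j _ => ?_
    simp [chi, div_pow]
    field_simp
  have h2 : (x.1 : ℂ) - z₀ = ((x.1 : ℂ) / z₀ - 1) * z₀ := by field_simp
  rw [h1, h2, norm_mul, Circle.norm_coe, mul_one, ← norm_mul, geom_sum_mul]
  refine (norm_sub_le _ _).trans ?_
  rw [norm_pow, norm_div, Circle.norm_coe, Circle.norm_coe, norm_one]
  norm_num

theorem norm_dk_sq (z₀ : Circle) (N : ℕ) (x : Torus) :
    ((‖dk z₀ N x‖ ^ 2 : ℝ) : ℂ) = ∑ j ∈ Finset.range N, ∑ l ∈ Finset.range N,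
      (z₀ : ℂ) ^ (l - j : ℤ) * chi (-(l - j)) 0 x := by
  have h := Complex.mul_conj' (dk z₀ N x)
  push_cast
  rw [← h, dk, map_sum, Finset.sum_mul_sum]
  refine Finset.sum_congr rfl fun j _ => Finset.sum_congr rfl fun l _ => ?_
  have hc : conj ((z₀ : ℂ) ^ (-l : ℤ)) = (z₀ : ℂ) ^ (l : ℤ) := by
    rw [map_zpow₀, ← Circle.coe_inv_eq_conj, Circle.coe_inv, inv_zpow', neg_neg]
  rw [map_mul, hc, conj_chi, mul_mul_mul_comm, chi_mul_chi, ← zpow_add₀ (Circle.coe_ne_zero _)]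
  congr 2 <;> ring

theorem integral_norm_dk_sq_mul (μ : Measure Torus) [IsFiniteMeasure μ] (z₀ : Circle) (N : ℕ)
    {F : Torus → ℂ} (hF : Continuous F) :
    ∫ x, ((‖dk z₀ N x‖ ^ 2 : ℝ) : ℂ) * F x ∂μ = ∑ j ∈ Finset.range N, ∑ l ∈ Finset.range N,
      (z₀ : ℂ) ^ (l - j : ℤ) * fc μ F (l - j) 0 := by
  simp only [norm_dk_sq, Finset.sum_mul]
  rw [integral_finsetSum _ fun j _ => integrable_torus (by fun_prop) μ]
  refine Finset.sum_congr rfl fun j _ => ?_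
  rw [integral_finsetSum _ fun j _ => integrable_torus (by fun_prop) μ]
  refine Finset.sum_congr rfl fun l _ => ?_
  rw [fc, ← integral_const_mul, neg_zero]
  congr! 2
  ring

/-- Fejér sums of a trigonometric polynomial. -/
theorem norm_fejer_sub_le (n : ℕ) (f : ℤ → ℂ) (hf : ∀ s : ℤ, n < |s| → f s = 0) :
    ∃ K : ℝ, ∀ N : ℕ, ‖∑ j ∈ Finset.range N, ∑ l ∈ Finset.range N, f (l - j) -
      N * ∑ s ∈ Finset.Icc (-(n : ℤ)) n, f s‖ ≤ K := by
  refine ⟨∑ s ∈ Finset.Icc (-(n : ℤ)) n, |s| * ‖f s‖, fun N => ?_⟩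
  -- Reindexing by `s = l - j`: a given `s` occurs for every `j < N` with `0 ≤ j + s < N`, that is,
  -- for all but at most `|s|` indices.
  have h1 : ∀ j ∈ Finset.range N, ∑ l ∈ Finset.range N, f (l - j) =
      ∑ s ∈ Finset.Icc (-(n : ℤ)) n, if 0 ≤ j + s ∧ j + s < N then f s else 0 := by
    intro j _
    rw [← Finset.sum_filter]
    have hinj : Set.InjOn (fun l : ℕ => (l : ℤ) - j) (Finset.range N) := fun a _ b _ h => by
      simpa using h
    rw [← Finset.sum_image (f := f) hinj]
    refine (Finset.sum_subset_zero_on_sdiff ?_ ?_ fun _ _ => rfl).symm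
    · intro s hs
      simp only [Finset.mem_filter, Finset.mem_Icc] at hs
      simp only [Finset.mem_image, Finset.mem_range]
      exact ⟨(j + s).toNat, by omega, by omega⟩
    · intro s hs
      simp only [Finset.mem_sdiff, Finset.mem_image, Finset.mem_range, Finset.mem_filter,
        Finset.mem_Icc, not_and, not_lt] at hs
      obtain ⟨⟨l, hl, rfl⟩, h⟩ := hs
      refine hf _ ?_
      by_contra hn
      rw [not_lt, abs_le] at hn
      have := h hn (by omega)
      omega
  rw [Finset.sum_congr rfl h1, Finset.sum_comm, Finset.mul_sum, ← Finset.sum_sub_distrib]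
  refine (norm_sum_le _ _).trans (Finset.sum_le_sum fun s _ => ?_)
  rw [← Finset.sum_filter, Finset.sum_const, nsmul_eq_mul, ← sub_mul, norm_mul]
  refine mul_le_mul_of_nonneg_right ?_ (norm_nonneg _)
  have hcard := Finset.card_filter_add_card_filter_not (s := Finset.range N)
    (fun j : ℕ => 0 ≤ (j : ℤ) + s ∧ (j : ℤ) + s < N)
  rw [Finset.card_range] at hcard
  have hle : (Finset.filter (fun j : ℕ => ¬(0 ≤ (j : ℤ) + s ∧ (j : ℤ) + s < N))
      (Finset.range N)).card ≤ s.natAbs := by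
    rcases le_total 0 s with hs | hs
    · have : Finset.filter (fun j : ℕ => ¬(0 ≤ (j : ℤ) + s ∧ (j : ℤ) + s < N)) (Finset.range N) ⊆
          Finset.Ico (N - s.natAbs) N := by
        intro j hj
        simp only [Finset.mem_filter, Finset.mem_range, Finset.mem_Ico] at hj ⊢
        omega
      refine (Finset.card_le_card this).trans ?_
      rw [Nat.card_Ico]
      omega
    · have : Finset.filter (fun j : ℕ => ¬(0 ≤ (j : ℤ) + s ∧ (j : ℤ) + s < N)) (Finset.range N) ⊆
          Finset.range s.natAbs := by
        intro j hj
        simp only [Finset.mem_filter, Finset.mem_range] at hj ⊢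
        omega
      exact (Finset.card_le_card this).trans (Finset.card_range _).le
  rw [← Complex.ofReal_natCast, ← Complex.ofReal_natCast, ← Complex.ofReal_sub, Complex.norm_real,
    Real.norm_eq_abs, abs_sub_comm, abs_of_nonneg (by
      rw [sub_nonneg, Nat.cast_le]; omega)]
  have habs : ((|s| : ℤ) : ℝ) = (s.natAbs : ℝ) := by rw [Nat.cast_natAbs]
  rw [habs, sub_le_iff_le_add']
  exact_mod_cast (by omega : N ≤ _ + s.natAbs)

end BernsteinSzego

/-! ### The measure `|d|² dμ` and the positivity of `e₀`. -/

namespace BernsteinSzego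

open Polynomial ComplexConjugate Filter Topology

section Kernel

variable {μ : Measure Torus} [IsFiniteMeasure μ] {n m : ℕ} {d : Bi}

/-- `d ∈ P_{2n,m}` is orthogonal to all `z ^ s * w ^ k`, `s ∈ ℤ`, `k ≥ 0`, except `z ^ n`. -/
structure IsKernel (μ : Measure Torus) (n m : ℕ) (d : Bi) : Prop where
  deg : Deg (2 * n) m d
  L_eq : ∀ (s : ℤ) (k : ℕ), L μ d s k = if s = n ∧ k = 0 then 1 else 0

theorem fc_norm_sq_neg (F : Torus → ℂ) (s k : ℤ) :
    fc μ (fun x => F x * conj (F x)) s k = conj (fc μ (fun x => F x * conj (F x)) (-s) (-k)) := by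
  rw [← fc_conj]
  simp only [map_mul, Complex.conj_conj, mul_comm]

theorem IsKernel.fc_sub (hd : IsKernel μ n m d) (i : ℕ) :
    fc μ (fun x => ev d x * conj (ev d x)) ((n : ℤ) - i) 0 = conj ((d.coeff 0).coeff i) := by
  have h := fc_mul_conj_dual hd.deg (t := 0) (M' := m) (k := 0) (fun s k _ => hd.L_eq s k)
    (by omega) ((n : ℤ) - i) i (by ring)
  simpa using h

theorem IsKernel.fc_add (hd : IsKernel μ n m d) (i : ℕ) :
    fc μ (fun x => ev d x * conj (ev d x)) ((i : ℤ) - n) 0 = (d.coeff 0).coeff i := by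
  rw [fc_norm_sq_neg, neg_sub, neg_zero, hd.fc_sub, Complex.conj_conj]

theorem IsKernel.fc_eq_zero (hd : IsKernel μ n m d) {s : ℤ} (hs : n < |s|) :
    fc μ (fun x => ev d x * conj (ev d x)) s 0 = 0 := by
  rcases abs_cases s with ⟨h, h'⟩ | ⟨h, h'⟩
  · have := hd.fc_add (n + s.natAbs)
    rw [hd.deg _ _ (Or.inr (by omega))] at this
    rw [← this]
    congr 1
    omega
  · have := hd.fc_sub (n + s.natAbs)
    rw [hd.deg _ _ (Or.inr (by omega)), map_zero] at this
    rw [← this]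
    congr 1
    omega

theorem IsKernel.fc_eq_zero_of_pos (hd : IsKernel μ n m d) (s : ℤ) {k : ℕ} (hk : 0 < k) :
    fc μ (fun x => ev d x * conj (ev d x)) s k = 0 := by
  rw [fc_ev_mul_conj_ev d hd.deg]
  refine Finset.sum_eq_zero fun l _ => Finset.sum_eq_zero fun i _ => ?_
  rw [← Nat.cast_add, hd.L_eq, if_neg (by omega), mul_zero]

theorem IsKernel.fc_mul_X_eq_zero (hd : IsKernel μ n m d) (g : Bi) (s : ℤ) :
    fc μ (fun x => ev d x * conj (ev (X * g) x)) s 0 = 0 := by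
  obtain ⟨N, M, hg⟩ := exists_deg (X * g)
  rw [fc_ev_mul_conj_ev d hg]
  refine Finset.sum_eq_zero fun l _ => Finset.sum_eq_zero fun i _ => ?_
  rcases Nat.eq_zero_or_pos l with rfl | hl
  · rw [coeff_X_mul_zero, coeff_zero, map_zero, zero_mul]
  · rw [zero_add, hd.L_eq, if_neg (by omega), mul_zero]

/-- The trigonometric polynomial `e₀` with `|d|² dμ = e₀ dσ`. -/
def e₀ (n : ℕ) (d : Bi) (z : ℂ) : ℂ := z ^ (-n : ℤ) * (d.coeff 0).eval z

theorem IsKernel.sum_eq (hd : IsKernel μ n m d) (z : Circle) :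
    ∑ s ∈ Finset.Icc (-(n : ℤ)) n, (z : ℂ) ^ s * fc μ (fun x => ev d x * conj (ev d x)) s 0 =
      e₀ n d z := by
  have hz : (z : ℂ) ≠ 0 := Circle.coe_ne_zero _
  rw [e₀, eval_eq_sum_range' (Nat.lt_succ_of_le (hd.deg.natDegree_coeff_le 0)), Finset.mul_sum]
  refine (Finset.sum_bij (fun (i : ℕ) _ => (i : ℤ) - n) ?_ ?_ ?_ ?_).symm
  · intro i hi
    simp at hi ⊢
    omega
  · intro a _ b _ h
    simpa using h
  · intro s hs
    simp at hs
    exact ⟨(s + n).toNat, by simp; omega, by omega⟩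
  · intro i _
    rw [hd.fc_add, sub_eq_add_neg, zpow_add₀ hz, zpow_natCast]
    ring

/-- The coefficients of `|d|² dμ` at `z^s w^0` vanish for `|s| > n`, so the double Fejér sum is `N
e₀(z)` up to an error bounded in `N`. -/
theorem IsKernel.exists_fejer_bound_complex (hd : IsKernel μ n m d) (z : Circle) :
    ∃ K : ℝ, ∀ N : ℕ,
      ‖((∫ x, ‖dk z N x‖ ^ 2 * ‖ev d x‖ ^ 2 ∂μ : ℝ) : ℂ) - N * e₀ n d z‖ ≤ K := by
  obtain ⟨K, hK⟩ := norm_fejer_sub_le n (fun s => (z : ℂ) ^ s *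
    fc μ (fun x => ev d x * conj (ev d x)) s 0) fun s hs => by rw [hd.fc_eq_zero hs, mul_zero]
  refine ⟨K, fun N => ?_⟩
  have h := hK N
  rw [hd.sum_eq z, ← integral_norm_dk_sq_mul μ z N (by fun_prop)] at h
  convert h using 3
  rw [← integral_complex_ofReal]
  refine integral_congr_ae (Filter.Eventually.of_forall fun x => ?_)
  simp only [Complex.mul_conj']
  push_cast
  rfl

theorem bound_of_forall_nat {a K : ℝ} (h : ∀ N : ℕ, N * a ≤ K) : a ≤ 0 := by
  by_contra! ha
  obtain ⟨N, hN⟩ := exists_nat_gt (K / a)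
  rw [div_lt_iff₀ ha] at hN
  exact (h N).not_gt hN

theorem IsKernel.e₀_eq_re (hd : IsKernel μ n m d) (z : Circle) :
    e₀ n d z = ((e₀ n d z).re : ℂ) := by
  obtain ⟨K, hK⟩ := hd.exists_fejer_bound_complex z
  have h : |(e₀ n d z).im| ≤ 0 := bound_of_forall_nat (K := K) fun N => by
    refine le_trans ?_ ((Complex.abs_im_le_norm _).trans (hK N))
    simp [abs_mul]
  exact Complex.ext rfl (by simpa using h)

theorem IsKernel.exists_fejer_bound (hd : IsKernel μ n m d) (z : Circle) :
    ∃ K : ℝ, 0 ≤ K ∧ ∀ N : ℕ,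
      |∫ x, ‖dk z N x‖ ^ 2 * ‖ev d x‖ ^ 2 ∂μ - N * (e₀ n d z).re| ≤ K := by
  obtain ⟨K, hK⟩ := hd.exists_fejer_bound_complex z
  refine ⟨K, (norm_nonneg _).trans (hK 0), fun N => ?_⟩
  have h := hK N
  rw [hd.e₀_eq_re z, ← Complex.ofReal_natCast, ← Complex.ofReal_mul, ← Complex.ofReal_sub,
    Complex.norm_real, Real.norm_eq_abs] at h
  exact h

theorem IsKernel.e₀_re_nonneg (hd : IsKernel μ n m d) (z : Circle) : 0 ≤ (e₀ n d z).re := by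
  obtain ⟨K, -, hK⟩ := hd.exists_fejer_bound z
  rw [← neg_nonpos]
  refine bound_of_forall_nat (K := K) fun N => ?_
  have h1 := (abs_le.1 (hK N)).2
  have h2 : 0 ≤ ∫ x, ‖dk z N x‖ ^ 2 * ‖ev d x‖ ^ 2 ∂μ := integral_nonneg fun x => by positivity
  linarith

/-- On the fibre over `z` the squared Dirichlet kernel equals `N²`, whereas the whole integral is
`O(N)`; so `|d|² dμ` gives the fibre no mass. -/
theorem IsKernel.ae_eq_zero (hd : IsKernel μ n m d) (z : Circle) :
    ∀ᵐ x ∂μ, x.1 = z → ev d x = 0 := by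
  obtain ⟨K, hK0, hK⟩ := hd.exists_fejer_bound z
  have hZ : MeasurableSet {x : Torus | x.1 = z} :=
    (isClosed_eq continuous_fst continuous_const).measurableSet
  have hint : Integrable (fun x => ‖ev d x‖ ^ 2) μ := integrable_torus (by fun_prop) μ
  have h0 : ∫ x in {x : Torus | x.1 = z}, ‖ev d x‖ ^ 2 ∂μ = 0 := by
    refine le_antisymm (bound_of_forall_nat (K := (e₀ n d z).re + K) fun N => ?_)
      (integral_nonneg fun x => by positivity)
    have he := hd.e₀_re_nonneg z
    rcases Nat.eq_zero_or_pos N with rfl | hN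
    · simp only [Nat.cast_zero, zero_mul]
      positivity
    have hN' : (1 : ℝ) ≤ N := by exact_mod_cast hN
    have h1 : (N : ℝ) ^ 2 * ∫ x in {x : Torus | x.1 = z}, ‖ev d x‖ ^ 2 ∂μ ≤
        ∫ x, ‖dk z N x‖ ^ 2 * ‖ev d x‖ ^ 2 ∂μ := by
      rw [← integral_const_mul]
      refine le_trans (le_of_eq ?_) (setIntegral_le_integral (s := {x : Torus | x.1 = z})
        (integrable_torus (by fun_prop) μ) (Filter.Eventually.of_forall fun x => by positivity))
      refine setIntegral_congr_fun hZ fun x hx => ?_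
      have hx' : x.1 = z := hx
      have hdk : dk z N x = N := by
        simp [dk, chi, hx']
      simp only [hdk, Complex.norm_natCast]
    have h2 := (abs_le.1 (hK N)).2
    have h3 : (N : ℝ) * (N * ∫ x in {x : Torus | x.1 = z}, ‖ev d x‖ ^ 2 ∂μ) ≤
        N * ((e₀ n d z).re + K) := by nlinarith
    exact le_of_mul_le_mul_left h3 (by linarith)
  rw [setIntegral_eq_zero_iff_of_nonneg_ae (Filter.Eventually.of_forall fun x => by positivity)
    hint.integrableOn] at h0
  filter_upwards [(ae_restrict_iff' hZ).1 h0] with x hx hxz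
  simpa using hx hxz

/-- Dominated convergence: the integrand is at most 1 and tends to 0 off the fibre over `z`.
Restricting to `d ≠ 0` discards the fibre, on which `μ` itself may have mass. -/
theorem IsKernel.tendsto_setIntegral_dk (hd : IsKernel μ n m d) (z : Circle) :
    Tendsto (fun N : ℕ => ∫ x in {x | ev d x ≠ 0}, ‖dk z N x‖ / N ∂μ) atTop (𝓝 0) := by
  have hS : MeasurableSet {x : Torus | ev d x ≠ 0} :=
    (isOpen_ne_fun (continuous_ev d) continuous_const).measurableSet
  rw [← integral_zero Torus ℝ (μ := μ.restrict {x | ev d x ≠ 0})]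
  refine tendsto_integral_of_dominated_convergence (fun _ => 1)
    (fun N => (by fun_prop : Continuous fun x => ‖dk z N x‖ / N).aestronglyMeasurable)
    (integrable_const _) (fun N => Filter.Eventually.of_forall fun x => ?_) ?_
  · rw [Real.norm_of_nonneg (by positivity)]
    exact div_le_one_of_le₀ (norm_dk_le z N x) (Nat.cast_nonneg _)
  · rw [ae_restrict_iff' hS]
    filter_upwards [hd.ae_eq_zero z] with x hx hxd
    have hxz : x.1 ≠ z := fun h => hxd (hx h)
    have hpos : 0 < ‖(x.1 : ℂ) - z‖ := norm_pos_iff.2 (sub_ne_zero.2 fun h => hxz (Circle.ext h))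
    refine squeeze_zero (fun N => by positivity) (fun N => ?_)
      (tendsto_const_div_atTop_nhds_zero_nat (2 / ‖(x.1 : ℂ) - z‖))
    gcongr
    rw [le_div_iff₀ hpos]
    exact norm_dk_mul_le z N x

theorem IsKernel.integral_dk_sq_mul (hd : IsKernel μ n m d) (z : Circle) (N : ℕ) :
    ∫ x, ((‖dk z N x‖ ^ 2 : ℝ) : ℂ) * (ev d x * chi (-n) 0 x) ∂μ = N := by
  rw [integral_norm_dk_sq_mul μ z N (by fun_prop)]
  have h : ∀ j l : ℕ, (z : ℂ) ^ (l - j : ℤ) *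
      fc μ (fun x => ev d x * chi (-n) 0 x) (l - j) 0 = if j = l then 1 else 0 := by
    intro j l
    have := hd.L_eq ((l : ℤ) - j - -n) 0
    rw [fc_mul_chi, sub_zero]
    rw [L, Nat.cast_zero] at this
    rw [this]
    by_cases hjl : j = l
    · subst hjl
      simp
    · rw [if_neg (by omega), if_neg hjl, mul_zero]
  simp only [h, Finset.sum_ite_eq]
  rw [Finset.sum_congr rfl fun j hj => if_pos hj]
  simp

theorem integral_eq_setIntegral_ne_zero {E : Type*} [NormedAddCommGroup E] [NormedSpace ℝ E]
    (F : Torus → E) (hF : ∀ x, ev d x = 0 → F x = 0) :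
    ∫ x, F x ∂μ = ∫ x in {x | ev d x ≠ 0}, F x ∂μ := by
  refine (setIntegral_eq_integral_of_forall_compl_eq_zero fun x hx => hF x ?_).symm
  simpa using hx

/-- If `e₀(z) = 0`, the integral of `|dk|² |d|²` stays bounded, while that of `|dk|² d z^{-n}` is
exactly `N`. A weighted arithmetic–geometric inequality contradicts this, its remaining term being
controlled by `IsKernel.tendsto_setIntegral_dk`. -/
theorem IsKernel.e₀_re_pos (hd : IsKernel μ n m d) (z : Circle) : 0 < (e₀ n d z).re := by
  refine lt_of_le_of_ne (hd.e₀_re_nonneg z) fun h0 => ?_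
  obtain ⟨K, hK0, hK⟩ := hd.exists_fejer_bound z
  -- With this choice `δ K ≤ 1`, so the limiting inequality reads `1 ≤ 1/2`.
  set δ : ℝ := 1 / (K + 1) with hδ
  have hδ0 : 0 < δ := by positivity
  have hle : ∀ N : ℕ, 0 < N →
      1 ≤ 1 / 2 * (δ * K + δ⁻¹ * ∫ x in {x | ev d x ≠ 0}, ‖dk z N x‖ / N ∂μ) := by
    intro N hN
    have hN' : (0 : ℝ) < N := by exact_mod_cast hN
    have hb := (abs_le.1 (hK N)).2
    rw [← h0, mul_zero, sub_zero, integral_eq_setIntegral_ne_zero (d := d) _ (fun x hx => by simp [hx])] at hb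
    have hI := hd.integral_dk_sq_mul z N
    rw [integral_eq_setIntegral_ne_zero (d := d) _ (fun x hx => by simp [hx])] at hI
    have h1 : (N : ℝ) ≤ ∫ x in {x | ev d x ≠ 0}, ‖dk z N x‖ ^ 2 * ‖ev d x‖ ∂μ := by
      have := norm_integral_le_integral_norm (μ := μ.restrict {x | ev d x ≠ 0})
        (fun x => ((‖dk z N x‖ ^ 2 : ℝ) : ℂ) * (ev d x * chi (-n) 0 x))
      rw [hI, Complex.norm_natCast] at this
      simpa using this
    have h2 : ∫ x in {x | ev d x ≠ 0}, ‖dk z N x‖ ^ 2 * ‖ev d x‖ ∂μ ≤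
        ∫ x in {x | ev d x ≠ 0}, (1 / 2 * (δ * N) * (‖dk z N x‖ ^ 2 * ‖ev d x‖ ^ 2) +
          1 / 2 * δ⁻¹ * N * (‖dk z N x‖ / N)) ∂μ := by
      refine integral_mono (integrable_torus (by fun_prop) _) (integrable_torus (by fun_prop) _)
        fun x => ?_
      have hk := norm_dk_le z N x
      have hk0 := norm_nonneg (dk z N x)
      -- The defect in `ab ≤ (a² + b²)/2`, plus the loss from replacing `|dk|²` by `N |dk|`.
      have hid : 1 / 2 * (δ * N) * (‖dk z N x‖ ^ 2 * ‖ev d x‖ ^ 2) +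
          1 / 2 * δ⁻¹ * N * (‖dk z N x‖ / N) - ‖dk z N x‖ ^ 2 * ‖ev d x‖ =
          1 / 2 * (δ * N)⁻¹ * (‖dk z N x‖ ^ 2 * (δ * N * ‖ev d x‖ - 1) ^ 2 +
            (N - ‖dk z N x‖) * ‖dk z N x‖) := by
        field_simp
        ring
      have hpos : 0 ≤ 1 / 2 * (δ * N)⁻¹ * (‖dk z N x‖ ^ 2 * (δ * N * ‖ev d x‖ - 1) ^ 2 +
            (N - ‖dk z N x‖) * ‖dk z N x‖) := by
        have : 0 ≤ N - ‖dk z N x‖ := by linarith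
        positivity
      simp only
      linarith
    rw [integral_add (integrable_torus (by fun_prop) _) (integrable_torus (by fun_prop) _),
      integral_const_mul, integral_const_mul] at h2
    have h3 : (N : ℝ) * 1 ≤ N * (1 / 2 * (δ * K +
        δ⁻¹ * ∫ x in {x | ev d x ≠ 0}, ‖dk z N x‖ / N ∂μ)) := by
      have h4 : 1 / 2 * (δ * N) * (∫ x in {x | ev d x ≠ 0}, ‖dk z N x‖ ^ 2 * ‖ev d x‖ ^ 2 ∂μ) ≤
          1 / 2 * (δ * N) * K := mul_le_mul_of_nonneg_left hb (by positivity)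
      linarith
    exact le_of_mul_le_mul_left h3 hN'
  have hlim : Tendsto (fun N : ℕ =>
      1 / 2 * (δ * K + δ⁻¹ * ∫ x in {x | ev d x ≠ 0}, ‖dk z N x‖ / N ∂μ)) atTop
      (𝓝 (1 / 2 * (δ * K + δ⁻¹ * 0))) :=
    (((hd.tendsto_setIntegral_dk z).const_mul _).const_add _).const_mul _
  have := ge_of_tendsto hlim ((Filter.eventually_gt_atTop 0).mono hle)
  rw [mul_zero, add_zero] at this
  have hδK : δ * K ≤ 1 := by
    rw [hδ, one_div, inv_mul_le_iff₀ (by positivity)]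
    linarith
  linarith

end Kernel

end BernsteinSzego

/-! ### Zero-freeness of `d` and reconstruction of `p`. -/

namespace BernsteinSzego

open Polynomial ComplexConjugate Filter Topology

variable {μ : Measure Torus} [IsFiniteMeasure μ] {n m : ℕ} {d : Bi}

theorem exists_norm_le {E : Type*} [NormedAddCommGroup E] {F : Torus → E} (hF : Continuous F) :
    ∃ K : ℝ, 0 ≤ K ∧ ∀ x, ‖F x‖ ≤ K := by
  obtain ⟨K, hK⟩ := isCompact_univ.exists_bound_of_continuousOn hF.continuousOn
  exact ⟨K, (norm_nonneg _).trans (hK (1, 1) trivial), fun x => hK x trivial⟩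

/-- At a zero, `d = (w - w₀) g + (ζ - z) r(ζ)`, where `ζ` is the first variable. Since `d ⟂ w g`
even with the weight `|dk|²`, Pythagoras and `|w₀| ≤ 1` bound the weighted norm of `d` by terms
containing `ζ - z`, which the kernel estimate makes `o(N)`. But that norm is `N e₀(z) + O(1)` with
`e₀(z) > 0`. -/
theorem IsKernel.evalEval_ne_zero (hd : IsKernel μ n m d) (z : Circle) {w₀ : ℂ} (hw : ‖w₀‖ ≤ 1) :
    d.evalEval (z : ℂ) w₀ ≠ 0 := by
  intro h0
  obtain ⟨g, hg⟩ : (X - C (C w₀)) ∣ d - C (d.eval (C w₀)) := X_sub_C_dvd_sub_C_eval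
  obtain ⟨r, hr⟩ : (X - C (z : ℂ)) ∣ d.eval (C w₀) := dvd_iff_isRoot.2 h0
  obtain ⟨G, hG0, hG⟩ := exists_norm_le (continuous_ev g)
  obtain ⟨R, hR0, hR⟩ := exists_norm_le (continuous_ev (C r))
  obtain ⟨K, -, hK⟩ := hd.exists_fejer_bound z
  have hpos := hd.e₀_re_pos z
  have hid : ∀ x : Torus, ev d x - x.2 * ev g x =
      ((x.1 : ℂ) - z) * ev (C r) x - w₀ * ev g x := by
    intro x
    have h := congrArg (fun P => ev P x) hg
    simp only [ev_sub, ev_mul, ev_C, ev_X, hr, eval_mul, eval_sub, eval_X, eval_C] at h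
    rw [ev_C]
    linear_combination h
  set S : Set Torus := {x | ev d x ≠ 0} with hS
  have hI : ∀ N, ∫ x in S, ‖dk z N x‖ ^ 2 * (ev d x * conj (x.2 * ev g x)).re ∂μ = 0 := by
    intro N
    have h1 : ∫ x in S, ((‖dk z N x‖ ^ 2 : ℝ) : ℂ) * (ev d x * conj (ev (X * g) x)) ∂μ = 0 := by
      rw [hS, ← integral_eq_setIntegral_ne_zero (d := d) _ (fun x hx => by simp [hx]),
        integral_norm_dk_sq_mul μ z N (by fun_prop)]
      simp only [hd.fc_mul_X_eq_zero, mul_zero, Finset.sum_const_zero]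
    have h2 := integral_re (𝕜 := ℂ) (μ := μ.restrict S)
      (f := fun x => ((‖dk z N x‖ ^ 2 : ℝ) : ℂ) * (ev d x * conj (ev (X * g) x)))
      (integrable_torus (by fun_prop) _)
    rw [h1] at h2
    simp only [RCLike.re_eq_complex_re, Complex.re_ofReal_mul, Complex.zero_re, ev_mul, ev_X] at h2
    exact h2
  -- Expanding `|d - w g|²`, the term `|g|²` cancels; each factor `T` is then absorbed by `D T ≤ 2`.
  have hpt : ∀ N (x : Torus), ‖dk z N x‖ ^ 2 * ‖ev d x‖ ^ 2 ≤
      2 * (‖dk z N x‖ ^ 2 * (ev d x * conj (x.2 * ev g x)).re) + 4 * G * R * ‖dk z N x‖ +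
        4 * R ^ 2 := by
    intro N x
    have e1 : ‖ev d x - x.2 * ev g x‖ ^ 2 = ‖ev d x‖ ^ 2 + ‖ev g x‖ ^ 2 -
        2 * (ev d x * conj (x.2 * ev g x)).re := by
      rw [← Complex.normSq_eq_norm_sq, Complex.normSq_sub, Complex.normSq_eq_norm_sq,
        Complex.normSq_eq_norm_sq, norm_mul, Circle.norm_coe, one_mul]
    have e2 : ‖ev d x - x.2 * ev g x‖ ≤ ‖(x.1 : ℂ) - z‖ * R + ‖ev g x‖ := by
      rw [hid]
      refine (norm_sub_le _ _).trans (add_le_add ?_ ?_)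
      · rw [norm_mul]
        exact mul_le_mul_of_nonneg_left (hR x) (norm_nonneg _)
      · rw [norm_mul]
        exact mul_le_of_le_one_left (norm_nonneg _) hw
    have e3 := pow_le_pow_left₀ (norm_nonneg _) e2 2
    rw [e1] at e3
    have e4 := norm_dk_mul_le z N x
    set D := ‖dk z N x‖
    set T := ‖(x.1 : ℂ) - z‖
    have hD : 0 ≤ D := norm_nonneg _
    have hT : 0 ≤ T := norm_nonneg _
    have hg0 : 0 ≤ ‖ev g x‖ := norm_nonneg _
    have e5 : ‖ev d x‖ ^ 2 ≤ 2 * (ev d x * conj (x.2 * ev g x)).re + 2 * T * R * ‖ev g x‖ +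
        T ^ 2 * R ^ 2 := by linarith
    have e6 := mul_le_mul_of_nonneg_left e5 (sq_nonneg D)
    have e7 : D * (D * T) * (R * ‖ev g x‖) ≤ D * 2 * (R * G) := by
      gcongr
      exact hG x
    have e8 : (D * T) ^ 2 * R ^ 2 ≤ 2 ^ 2 * R ^ 2 := by gcongr
    linarith
  have hle : ∀ N : ℕ, 0 < N → (e₀ n d z).re ≤
      (K + 4 * R ^ 2 * μ.real Set.univ) / N + 4 * G * R * ∫ x in S, ‖dk z N x‖ / N ∂μ := by
    intro N hN
    have hN' : (0 : ℝ) < N := by exact_mod_cast hN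
    have hb := (abs_le.1 (hK N)).1
    rw [integral_eq_setIntegral_ne_zero (d := d) _ (fun x hx => by simp [hx])] at hb
    have h1 : ∫ x in S, ‖dk z N x‖ ^ 2 * ‖ev d x‖ ^ 2 ∂μ ≤
        ∫ x in S, (2 * (‖dk z N x‖ ^ 2 * (ev d x * conj (x.2 * ev g x)).re) +
          4 * G * R * N * (‖dk z N x‖ / N) + 4 * R ^ 2) ∂μ := by
      have hc2 : Continuous fun x : Torus => (x.2 : ℂ) := continuous_subtype_val.comp continuous_snd
      have hc : Continuous fun x : Torus => (ev d x * conj (x.2 * ev g x)).re :=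
        Complex.continuous_re.comp (by fun_prop)
      refine integral_mono (integrable_torus (by fun_prop) _) (integrable_torus (by fun_prop) _)
        fun x => (hpt N x).trans_eq ?_
      field_simp
    have hc2 : Continuous fun x : Torus => (x.2 : ℂ) := continuous_subtype_val.comp continuous_snd
    have hc : Continuous fun x : Torus => (ev d x * conj (x.2 * ev g x)).re :=
      Complex.continuous_re.comp (by fun_prop)
    rw [integral_add (integrable_torus (by fun_prop) _) (integrable_torus (by fun_prop) _),
      integral_add (integrable_torus (by fun_prop) _) (integrable_torus (by fun_prop) _),
      integral_const_mul, integral_const_mul, hI, integral_const, measureReal_restrict_apply_univ,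
      smul_eq_mul] at h1
    have h2 : μ.real S * (4 * R ^ 2) ≤ μ.real Set.univ * (4 * R ^ 2) :=
      mul_le_mul_of_nonneg_right (measureReal_mono (Set.subset_univ _)) (by positivity)
    rw [← sub_le_iff_le_add, le_div_iff₀ hN']
    linarith
  have hlim : Tendsto (fun N : ℕ => (K + 4 * R ^ 2 * μ.real Set.univ) / N +
      4 * G * R * ∫ x in S, ‖dk z N x‖ / N ∂μ) atTop (𝓝 (0 + 4 * G * R * 0)) :=
    (tendsto_const_div_atTop_nhds_zero_nat _).add ((hd.tendsto_setIntegral_dk z).const_mul _)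
  have := ge_of_tendsto hlim ((Filter.eventually_gt_atTop 0).mono hle)
  rw [mul_zero, add_zero] at this
  exact this.not_gt hpos

theorem integral_withDensity_ofReal {μ : Measure Torus} {g : Torus → ℝ} (hg : Measurable g)
    (hg0 : ∀ x, 0 ≤ g x) (F : Torus → ℂ) :
    ∫ x, F x ∂(μ.withDensity fun x => ENNReal.ofReal (g x)) = ∫ x, (g x : ℂ) * F x ∂μ := by
  rw [integral_withDensity_eq_integral_toReal_smul (by fun_prop)
    (Eventually.of_forall fun x => ENNReal.ofReal_lt_top)]
  simp only [ENNReal.toReal_ofReal (hg0 _), Complex.real_smul]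

theorem fc_withDensity_ofReal {μ : Measure Torus} {g : Torus → ℝ} (hg : Measurable g)
    (hg0 : ∀ x, 0 ≤ g x) (F : Torus → ℂ) (s k : ℤ) :
    fc (μ.withDensity fun x => ENNReal.ofReal (g x)) F s k = fc μ (fun x => (g x : ℂ) * F x) s k := by
  simp only [fc, mul_assoc]
  exact integral_withDensity_ofReal hg hg0 _

theorem e₀_eq_ev (d : Bi) (x : Torus) :
    e₀ n d x.1 = ev (C (d.coeff 0)) x * chi (-n) 0 x := by
  rw [e₀, ev_C, chi, zpow_zero, mul_one, mul_comm]

theorem fc_e₀ (hd : Deg (2 * n) m d) (s k : ℤ) :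
    fc sigma (fun x => e₀ n d x.1) s k =
      if k = 0 ∧ -n ≤ s then (d.coeff 0).coeff (s + n).toNat else 0 := by
  simp only [e₀_eq_ev]
  rw [fc_mul_chi]
  have h := (deg_C (hd.natDegree_coeff_le 0)).L_eq (μ := sigma) (s - -n) (k - 0)
  rw [L] at h
  rw [h]
  simp only [zero_add, Finset.range_one, Finset.sum_singleton, coeff_C_zero, fc_one_sigma]
  have h1 : ∀ i ∈ Finset.range (2 * n + 1), (d.coeff 0).coeff i *
      (if s - -n - (i : ℤ) = 0 ∧ k - 0 - ((0 : ℕ) : ℤ) = 0 then (1 : ℂ) else 0) =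
      if i = (s + n).toNat then (if k = 0 ∧ -n ≤ s then (d.coeff 0).coeff (s + n).toNat else 0)
        else 0 := by
    intro i _
    by_cases hi : i = (s + n).toNat
    · rw [if_pos hi, ← hi]
      by_cases hk : k = 0 ∧ -n ≤ s
      · rw [if_pos (by omega), if_pos hk, mul_one]
      · rw [if_neg (by omega), if_neg hk, mul_zero]
    · rw [if_neg (by omega), if_neg hi, mul_zero]
  rw [Finset.sum_congr rfl h1, Finset.sum_ite_eq']
  split_ifs with h2 h3 h3
  · rfl
  · rfl
  · rw [hd 0 _ (Or.inr (by simpa [Nat.lt_succ_iff] using h2))]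
  · rfl

/-- All Fourier coefficients agree: those at `w^k`, `k ≠ 0`, vanish on both sides, and those at
`w^0` are the coefficients of `e₀`. -/
theorem IsKernel.withDensity_eq (hd : IsKernel μ n m d) :
    (μ.withDensity fun x => ENNReal.ofReal (‖ev d x‖ ^ 2)) =
      sigma.withDensity fun x => ENNReal.ofReal (e₀ n d x.1).re := by
  have hce : Continuous fun x : Torus => (e₀ n d x.1).re := by
    simp only [e₀_eq_ev]
    exact Complex.continuous_re.comp (by fun_prop)
  have hcd : Continuous fun x : Torus => ‖ev d x‖ ^ 2 := by fun_prop
  have h1 : IsFiniteMeasure (μ.withDensity fun x => ENNReal.ofReal (‖ev d x‖ ^ 2)) :=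
    isFiniteMeasure_withDensity_ofReal (integrable_torus hcd μ).2
  have h2 : IsFiniteMeasure (sigma.withDensity fun x => ENNReal.ofReal (e₀ n d x.1).re) :=
    isFiniteMeasure_withDensity_ofReal (integrable_torus hce sigma).2
  refine ext_of_fc_eq fun s k => ?_
  rw [fc_withDensity_ofReal hcd.measurable (fun x => by positivity),
    fc_withDensity_ofReal hce.measurable fun x => hd.e₀_re_nonneg x.1]
  simp only [mul_one, ← hd.e₀_eq_re, Complex.ofReal_pow, ← Complex.mul_conj']
  rw [fc_e₀ hd.deg]
  rcases lt_trichotomy k 0 with hk | rfl | hk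
  · rw [if_neg (by omega), fc_norm_sq_neg]
    obtain ⟨j, hj⟩ := Int.eq_ofNat_of_zero_le (show 0 ≤ -k by omega)
    rw [hj, hd.fc_eq_zero_of_pos _ (by omega), map_zero]
  · by_cases hs : -n ≤ s
    · rw [if_pos ⟨rfl, hs⟩, ← hd.fc_add]
      congr 1
      omega
    · rw [if_neg (by omega), hd.fc_eq_zero (by rw [lt_abs]; omega)]
  · rw [if_neg (by omega)]
    lift k to ℕ using hk.le
    exact hd.fc_eq_zero_of_pos _ (by omega)

theorem isBernsteinSzego_iff (μ : Measure Torus) (n m : ℕ) :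
    IsBernsteinSzego μ n m ↔ ∃ p : Bi, Deg n m p ∧
      (∀ z w : ℂ, ‖z‖ = 1 → ‖w‖ ≤ 1 → p.evalEval z w ≠ 0) ∧
      μ = sigma.withDensity fun x => ENNReal.ofReal (1 / ‖ev p x‖ ^ 2) := by
  simp only [IsBernsteinSzego, degreeLE_iff, NoZeros, evalAt_eq_evalEval, bernsteinSzego]
  constructor
  · rintro ⟨p, h1, h2, h3⟩
    exact ⟨toBi p, h1, h2, h3⟩
  · rintro ⟨p, h1, h2, h3⟩
    exact ⟨toBi.symm p, by simpa using h1, by simpa using h2, by simpa [ev] using h3⟩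

theorem isBernsteinSzego_of_stable (hμ : NonDegenerate μ)
    (hE : ∀ M, m ≤ M + 1 → EStable μ n M) (hH : HStable μ n m) : IsBernsteinSzego μ n m := by
  obtain ⟨d, hdeg, hL, hrev, hdvd⟩ := exists_kernel hμ hE hH
  have hd : IsKernel μ n m d := ⟨hdeg, hL⟩
  have hA : ∀ z : Circle, (d.coeff 0).eval (z : ℂ) = (z : ℂ) ^ n * ((e₀ n d z).re : ℂ) := by
    intro z
    rw [← hd.e₀_eq_re, e₀, zpow_neg, zpow_natCast, mul_inv_cancel_left₀
      (pow_ne_zero _ (Circle.coe_ne_zero z))]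
  -- The `q a` become the `w`-coefficients of `p`; with `δ = n` their degree drops from `2n` to `n`.
  obtain ⟨q, hq, hqV⟩ := exists_factorization n n (d.coeff 0) (fun a => d.coeff a)
    (hdeg.natDegree_coeff_le 0) hrev (fun z hz => by
      have := hA ⟨z, mem_sphere_zero_iff_norm.2 hz⟩
      exact ⟨_, hd.e₀_re_pos _, this⟩)
    (fun a => by have := hdeg.natDegree_coeff_le a; omega)
    (fun a b => by rw [← two_mul]; exact hdvd a b)
  have hqV' : ∀ (z : Circle) a b, (d.coeff a).eval (z : ℂ) * conj ((d.coeff b).eval (z : ℂ)) =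
      (q a).eval (z : ℂ) * conj ((q b).eval (z : ℂ)) * ((e₀ n d z).re : ℂ) := by
    intro z a b
    have h := hqV z (Circle.norm_coe z) a b
    rw [hA] at h
    refine mul_right_cancel₀ (pow_ne_zero n (Circle.coe_ne_zero z)) ?_
    linear_combination h
  set p : Bi := ∑ a ∈ Finset.range (m + 1), C (q a) * X ^ a with hp
  have hpz : ∀ z w : ℂ, p.evalEval z w = ∑ a ∈ Finset.range (m + 1), (q a).eval z * w ^ a := by
    intro z w
    simp only [hp, evalEval_finsetSum, evalEval_mul, evalEval_C, evalEval_pow, evalEval_X]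
  have hpdeg : Deg n m p := Deg.sum fun a ha =>
    ((deg_X_pow a).C_mul (hq a)).mono (by omega) (by simp at ha; omega)
  -- Valid for all `w`, not only on the circle, so a zero of `p` in `𝕋 × 𝔻̄` would be one of `d`.
  have hmul : ∀ (z : Circle) (w : ℂ), d.evalEval (z : ℂ) w * conj ((d.coeff 0).eval (z : ℂ)) =
      p.evalEval (z : ℂ) w * conj ((q 0).eval (z : ℂ)) * ((e₀ n d z).re : ℂ) := by
    intro z w
    rw [hdeg.evalEval_eq, hpz, Finset.sum_mul, Finset.sum_mul, Finset.sum_mul]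
    refine Finset.sum_congr rfl fun a _ => ?_
    linear_combination w ^ a * hqV' z a 0
  have hnorm : ∀ x : Torus, ‖ev d x‖ ^ 2 = (e₀ n d x.1).re * ‖ev p x‖ ^ 2 := by
    intro x
    have h : ev d x * conj (ev d x) = ((e₀ n d x.1).re : ℂ) * (ev p x * conj (ev p x)) := by
      rw [ev, ev, hdeg.evalEval_eq, hpz, map_sum, map_sum, Finset.sum_mul_sum, Finset.sum_mul_sum,
        Finset.mul_sum]
      refine Finset.sum_congr rfl fun a _ => ?_
      rw [Finset.mul_sum]
      refine Finset.sum_congr rfl fun b _ => ?_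
      rw [map_mul, map_mul]
      linear_combination ((x.2 : ℂ) ^ a * conj ((x.2 : ℂ) ^ b)) * hqV' x.1 a b
    rw [Complex.mul_conj', Complex.mul_conj'] at h
    exact_mod_cast h
  rw [isBernsteinSzego_iff]
  refine ⟨p, hpdeg, fun z w hz hw h0 => ?_, ?_⟩
  · have h := hmul ⟨z, mem_sphere_zero_iff_norm.2 hz⟩ w
    have hd0 := hd.evalEval_ne_zero ⟨z, mem_sphere_zero_iff_norm.2 hz⟩ hw
    have hA0 := hA ⟨z, mem_sphere_zero_iff_norm.2 hz⟩
    have hpos := hd.e₀_re_pos ⟨z, mem_sphere_zero_iff_norm.2 hz⟩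
    change d.evalEval z w * conj ((d.coeff 0).eval z) =
      p.evalEval z w * conj ((q 0).eval z) * _ at h
    rw [h0, zero_mul, zero_mul, mul_eq_zero, map_eq_zero] at h
    refine h.elim hd0 fun h => ?_
    change (d.coeff 0).eval z = z ^ n * _ at hA0
    rw [h] at hA0
    exact mul_ne_zero (pow_ne_zero n (ne_zero_of_norm hz)) (Complex.ofReal_ne_zero.2 hpos.ne')
      hA0.symm
  · have hdx : ∀ x : Torus, ‖ev d x‖ ^ 2 ≠ 0 := fun x =>
      pow_ne_zero 2 (norm_ne_zero_iff.2 (hd.evalEval_ne_zero x.1 (Circle.norm_coe x.2).le))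
    have hce : Continuous fun x : Torus => (e₀ n d x.1).re := by
      simp only [e₀_eq_ev]
      exact Complex.continuous_re.comp (by fun_prop)
    have hcd : Continuous fun x : Torus => ‖ev d x‖ ^ 2 := by fun_prop
    have hmd : Measurable fun x : Torus => ENNReal.ofReal (‖ev d x‖ ^ 2) :=
      hcd.measurable.ennreal_ofReal
    have h1 := withDensity_inv_same (μ := μ) hmd
      (Eventually.of_forall fun x => by
        rw [ne_eq, ENNReal.ofReal_eq_zero, not_le]
        exact lt_of_le_of_ne (by positivity) (hdx x).symm)
      (Eventually.of_forall fun x => ENNReal.ofReal_ne_top)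
    rw [← h1, hd.withDensity_eq]
    refine (withDensity_mul sigma hce.measurable.ennreal_ofReal hmd.inv).symm.trans ?_
    congr 1
    funext x
    have hpos := hd.e₀_re_pos x.1
    have hp0 : 0 < ‖ev d x‖ ^ 2 := lt_of_le_of_ne (by positivity) (hdx x).symm
    rw [Pi.mul_apply, Pi.inv_apply, ← ENNReal.ofReal_inv_of_pos hp0,
      ← ENNReal.ofReal_mul hpos.le]
    congr 1
    rw [hnorm, mul_inv, mul_inv_cancel_left₀ hpos.ne', one_div]

end BernsteinSzego

/-! ### From dual polynomials and decay to the stability of `E²`. -/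

namespace BernsteinSzego

open Polynomial ComplexConjugate Filter Topology

variable {μ : Measure Torus} [IsFiniteMeasure μ] {n M : ℕ}

theorem norm_L_le (P : Bi) (s k : ℤ) {ε K : ℝ} (hε : 0 < ε)
    (hP : ∫ x, ‖ev P x‖ ^ 2 ∂μ ≤ K * ε ^ 2) :
    ‖L μ P s k‖ ≤ 1 / 2 * (K + μ.real Set.univ) * ε := by
  have h1 : ‖L μ P s k‖ ≤ ∫ x, ‖ev P x‖ ∂μ := by
    refine (norm_integral_le_integral_norm _).trans_eq ?_
    simp
  have h2 : ∫ x, ‖ev P x‖ ∂μ ≤ ∫ x, (1 / 2 * ε⁻¹ * ‖ev P x‖ ^ 2 + 1 / 2 * ε) ∂μ := by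
    refine integral_mono (integrable_torus (by fun_prop) _) (integrable_torus (by fun_prop) _)
      fun x => ?_
    have h : 1 / 2 * ε⁻¹ * ‖ev P x‖ ^ 2 + 1 / 2 * ε - ‖ev P x‖ =
        1 / 2 * ε⁻¹ * (‖ev P x‖ - ε) ^ 2 := by
      field_simp
      ring
    have : 0 ≤ 1 / 2 * ε⁻¹ * (‖ev P x‖ - ε) ^ 2 := by positivity
    simp only
    linarith
  rw [integral_add (integrable_torus (by fun_prop) _) (integrable_torus (by fun_prop) _),
    integral_const_mul, integral_const, smul_eq_mul] at h2
  have h3 : 1 / 2 * ε⁻¹ * ∫ x, ‖ev P x‖ ^ 2 ∂μ ≤ 1 / 2 * ε⁻¹ * (K * ε ^ 2) :=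
    mul_le_mul_of_nonneg_left hP (by positivity)
  have h4 : 1 / 2 * ε⁻¹ * (K * ε ^ 2) = 1 / 2 * K * ε := by field_simp
  linarith

theorem eq_zero_of_norm_le {a : ℂ} {c : ℝ} (hc : 0 ≤ c) (h : ∀ ε : ℝ, 0 < ε → ‖a‖ ≤ c * ε) :
    a = 0 := by
  by_contra hne
  have ha : 0 < ‖a‖ := norm_pos_iff.2 hne
  have h9 := h (‖a‖ / (c + 1)) (by positivity)
  rw [mul_div_assoc', le_div_iff₀ (by positivity)] at h9
  nlinarith

/-- A decaying solution of the banded recurrence `hcoef` that vanishes on `1, …, N` vanishes beyond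
`N`. Its truncation at `R` is the sequence of inner products of a polynomial `h`. The recurrence
leaves in the squared norm of `h` only boundary terms near `R`, which are `O(ε²)`; hence `g r k`, an
inner product of `h`, is `O(ε)`. -/
theorem tail_eq_zero {d : ℕ → Bi} (hd : ∀ t ≤ M, Deg (2 * n) M (d t))
    (hdL : ∀ t ≤ M, ∀ s : ℤ, ∀ l ≤ M,
      L μ (d t) s l = if s = n ∧ l = t then 1 else 0) {N : ℕ} {g : ℤ → ℕ → ℂ}
    (hg0 : ∀ s : ℤ, 1 ≤ s → s ≤ N → ∀ l ≤ M, g s l = 0)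
    (hcoef : ∀ t ≤ M, ∀ s : ℕ, N < s → ∑ l ∈ Finset.range (M + 1),
      ∑ i ∈ Finset.range (2 * n + 1), conj (((d t).coeff l).coeff i) * g (s - n + i) l = 0)
    (hlim : ∀ l : ℕ, Tendsto (fun s : ℕ => g s l) atTop (𝓝 0)) (hN : n ≤ N)
    (r : ℕ) (hr : N < r) (k : ℕ) (hk : k ≤ M) : g r k = 0 := by
  set B : ℝ := ∑ t ∈ Finset.range (M + 1), ∑ l ∈ Finset.range (M + 1),
    ∑ i ∈ Finset.range (2 * n + 1), ‖((d t).coeff l).coeff i‖ with hB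
  have hBt : ∀ t ∈ Finset.range (M + 1), ∑ l ∈ Finset.range (M + 1),
      ∑ i ∈ Finset.range (2 * n + 1), ‖((d t).coeff l).coeff i‖ ≤ B := fun t ht =>
    Finset.single_le_sum (f := fun t => ∑ l ∈ Finset.range (M + 1),
      ∑ i ∈ Finset.range (2 * n + 1), ‖((d t).coeff l).coeff i‖)
      (fun t _ => by positivity) ht
  have hB0 : 0 ≤ B := by positivity
  have hbound : ∀ ε : ℝ, 0 < ε →
      ‖g r k‖ ≤ 1 / 2 * (n * ((M + 1) * B) + μ.real Set.univ) * ε := by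
    intro ε hε
    have hev : ∀ᶠ s : ℕ in atTop, ∀ l ∈ Finset.range (M + 1), ‖g s l‖ ≤ ε := by
      rw [Filter.eventually_all_finset]
      intro l _
      have := (hlim l).norm
      rw [norm_zero] at this
      exact this.eventually_le_const hε
    obtain ⟨S, hS⟩ := eventually_atTop.1 hev
    set R := S + n + r with hR
    set h : Bi := ∑ s ∈ Finset.Ioc N R, ∑ t ∈ Finset.range (M + 1),
      g s t • (C (X ^ (s - n)) * d t) with hh
    have hL : ∀ (q : ℤ) (l : ℕ), l ≤ M → L μ h q l = if N < q ∧ q ≤ R then g q l else 0 := by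
      intro q l hl
      rw [hh, L_sum]
      have h1 : ∀ s ∈ Finset.Ioc N R, L μ (∑ t ∈ Finset.range (M + 1),
          g s t • (C (X ^ (s - n)) * d t)) q l = if (s : ℤ) = q then g q l else 0 := by
        intro s hs
        rw [L_sum]
        have h2 : ∀ t ∈ Finset.range (M + 1), L μ (g s t • (C (X ^ (s - n)) * d t)) q l =
            if l = t then (if (s : ℤ) = q then g q l else 0) else 0 := by
          intro t ht
          simp at ht hs
          rw [L_smul, L_C_X_pow_mul, hdL t (by omega) _ l hl, Nat.cast_sub (by omega)]
          by_cases hlt : l = t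
          · by_cases hsq : (s : ℤ) = q
            · rw [if_pos (by omega), if_pos hlt, if_pos hsq, mul_one, hsq, hlt]
            · rw [if_neg (by omega), if_pos hlt, if_neg hsq, mul_zero]
          · rw [if_neg (by omega), if_neg hlt, mul_zero]
        rw [Finset.sum_congr rfl h2, Finset.sum_ite_eq, if_pos (by simp; omega)]
      rw [Finset.sum_congr rfl h1]
      by_cases hq : N < q ∧ q ≤ R
      · lift q to ℕ using by omega
        simp only [Nat.cast_inj]
        rw [Finset.sum_ite_eq', if_pos (by simp; omega), if_pos hq]
      · rw [if_neg hq]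
        refine Finset.sum_eq_zero fun s hs => if_neg ?_
        rintro rfl
        simp at hs
        omega
    -- These are the recurrence sums of the truncated sequence. The cut at `N` is harmless, since `s
    -- - n ≥ 1` and `g` vanishes on `1, …, N`; the cut at `R` is felt only for `s > R - n`.
    have hin : ∀ s ∈ Finset.Ioc N R, ∀ t ∈ Finset.range (M + 1),
        ‖fc μ (fun x => ev h x * conj (ev (d t) x)) (s - n) 0‖ ≤
          if R - n < s then B * ε else 0 := by
      intro s hs t ht
      have hs' : N < s ∧ s ≤ R := by simpa using hs
      have ht' : t ≤ M := by simp at ht; omega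
      rw [fc_ev_mul_conj_ev h (hd t ht')]
      simp only [zero_add]
      have h0 := hcoef t ht' s hs'.1
      have hterm : ∀ l ∈ Finset.range (M + 1), ∀ i ∈ Finset.range (2 * n + 1),
          ‖g (s - n + i) l - L μ h (s - n + i) l‖ ≤ if R - n < s then ε else 0 := by
        intro l hl i hi
        have hl' : l ≤ M := by simp at hl; omega
        have hi' : i ≤ 2 * n := by simp at hi; omega
        rw [hL _ l hl']
        by_cases hq : (N : ℤ) < s - n + i ∧ (s : ℤ) - n + i ≤ R
        · rw [if_pos hq, sub_self, norm_zero]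
          split_ifs <;> linarith
        · rw [if_neg hq, sub_zero]
          by_cases hq' : (s : ℤ) - n + i ≤ N
          · rw [hg0 _ (by omega) hq' l hl', norm_zero]
            split_ifs <;> linarith
          · rw [if_pos (by omega)]
            obtain ⟨q, hq2⟩ := Int.eq_ofNat_of_zero_le (show 0 ≤ (s : ℤ) - n + i by omega)
            rw [hq2]
            exact hS q (by omega) l hl
      have hsplit : ∑ l ∈ Finset.range (M + 1), ∑ i ∈ Finset.range (2 * n + 1),
          conj (((d t).coeff l).coeff i) * L μ h (s - n + i) l =
          -∑ l ∈ Finset.range (M + 1), ∑ i ∈ Finset.range (2 * n + 1),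
            conj (((d t).coeff l).coeff i) *
              (g (s - n + i) l - L μ h (s - n + i) l) := by
        simp only [mul_sub, Finset.sum_sub_distrib, h0]
        ring
      rw [hsplit, norm_neg]
      calc _ ≤ ∑ l ∈ Finset.range (M + 1), ∑ i ∈ Finset.range (2 * n + 1),
              ‖((d t).coeff l).coeff i‖ * (if R - n < s then ε else 0) := by
            refine (norm_sum_le _ _).trans (Finset.sum_le_sum fun l hl =>
              (norm_sum_le _ _).trans (Finset.sum_le_sum fun i hi => ?_))
            rw [norm_mul, RCLike.norm_conj]
            exact mul_le_mul_of_nonneg_left (hterm l hl i hi) (norm_nonneg _)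
        _ = (∑ l ∈ Finset.range (M + 1), ∑ i ∈ Finset.range (2 * n + 1),
              ‖((d t).coeff l).coeff i‖) * (if R - n < s then ε else 0) := by
            simp only [Finset.sum_mul]
        _ ≤ B * (if R - n < s then ε else 0) :=
            mul_le_mul_of_nonneg_right (hBt t ht) (by split_ifs <;> linarith)
        _ = _ := by rw [mul_ite, mul_zero]
    have hnorm : ∫ x, ‖ev h x‖ ^ 2 ∂μ ≤ n * ((M + 1) * B) * ε ^ 2 := by
      have h1 := norm_sq_eq_fc μ (ev h)
      have h2 : (fun x => ev h x * conj (ev h x)) = fun x => ∑ s ∈ Finset.Ioc N R,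
          ∑ t ∈ Finset.range (M + 1), conj (g s t) *
            ((ev h x * conj (ev (d t) x)) * chi (-((s : ℤ) - n)) 0 x) := by
        funext x
        conv_lhs => rw [hh, ← hh]
        have h3 : ev h x = ∑ s ∈ Finset.Ioc N R, ∑ t ∈ Finset.range (M + 1),
            g s t * (chi ((s : ℤ) - n) 0 x * ev (d t) x) := by
          rw [hh, ev_sum]
          refine Finset.sum_congr rfl fun s hs => ?_
          rw [ev_sum]
          refine Finset.sum_congr rfl fun t _ => ?_
          have hs' : n ≤ s := by simp at hs; omega
          rw [ev_smul, ev_mul, ev_C, ← Nat.cast_sub hs']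
          simp [chi]
        conv_lhs => rw [h3, ← h3]
        nth_rewrite 2 [h3]
        rw [map_sum, Finset.mul_sum]
        refine Finset.sum_congr rfl fun s _ => ?_
        rw [map_sum, Finset.mul_sum]
        refine Finset.sum_congr rfl fun t _ => ?_
        rw [map_mul, map_mul, conj_chi, neg_zero]
        ring
      rw [h2, fc_sum _ fun s _ => by fun_prop] at h1
      have h4 : ∀ s ∈ Finset.Ioc N R, ‖fc μ (fun x => ∑ t ∈ Finset.range (M + 1), conj (g s t) *
            ((ev h x * conj (ev (d t) x)) * chi (-((s : ℤ) - n)) 0 x)) 0 0‖ ≤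
            if R - n < s then (M + 1) * B * ε ^ 2 else 0 := by
        intro s hs
        rw [fc_sum _ fun s _ => by fun_prop]
        refine (norm_sum_le _ _).trans ?_
        have h5 : ∀ t ∈ Finset.range (M + 1), ‖fc μ (fun x => conj (g s t) *
            ((ev h x * conj (ev (d t) x)) * chi (-((s : ℤ) - n)) 0 x)) 0 0‖ ≤
            if R - n < s then B * ε ^ 2 else 0 := by
          intro t ht
          rw [fc_const_mul, fc_mul_chi, norm_mul, RCLike.norm_conj, zero_sub, neg_neg, sub_zero]
          have h6 := hin s hs t ht
          by_cases hRs : R - n < s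
          · rw [if_pos hRs] at h6 ⊢
            calc _ ≤ ε * (B * ε) := mul_le_mul (hS s (by omega) t ht) h6 (norm_nonneg _) hε.le
              _ = _ := by ring
          · rw [if_neg hRs] at h6 ⊢
            rw [le_antisymm h6 (norm_nonneg _), mul_zero]
        refine (Finset.sum_le_sum h5).trans_eq ?_
        rw [Finset.sum_const, Finset.card_range, nsmul_eq_mul, mul_ite, mul_zero]
        push_cast
        congr 1
        ring
      have h7 : ‖((∫ x, ‖ev h x‖ ^ 2 ∂μ : ℝ) : ℂ)‖ ≤ n * ((M + 1) * B) * ε ^ 2 := by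
        rw [h1]
        refine (norm_sum_le _ _).trans ((Finset.sum_le_sum h4).trans ?_)
        rw [← Finset.sum_filter, Finset.sum_const, nsmul_eq_mul]
        have hcard : (Finset.filter (fun s => R - n < s) (Finset.Ioc N R)).card ≤ n := by
          have : Finset.filter (fun s => R - n < s) (Finset.Ioc N R) ⊆ Finset.Ioc (R - n) R := by
            intro s hs
            simp only [Finset.mem_filter, Finset.mem_Ioc] at hs ⊢
            omega
          refine (Finset.card_le_card this).trans ?_
          rw [Nat.card_Ioc]
          omega
        rw [mul_assoc (n : ℝ)]
        exact mul_le_mul_of_nonneg_right (by exact_mod_cast hcard) (by positivity)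
      rw [Complex.norm_real] at h7
      exact (le_abs_self _).trans h7
    have h8 := norm_L_le h r k hε hnorm
    rwa [hL r k hk, if_pos (by omega)] at h8
  exact eq_zero_of_norm_le (by positivity) hbound

/-- Pairing `P` with shifted duals recovers its coefficients, so the inner products of `P` satisfy a
recurrence wherever these vanish, in particular beyond `N`. Once all products with `s ≥ 1` are zero,
so are the coefficients beyond `n`. -/
theorem HasDual.eStable (hD : HasDual μ n M)
    (hlim : ∀ (P : Bi) (k : ℕ), Tendsto (fun s : ℕ => L μ P s k) atTop (𝓝 0)) :
    EStable μ n M := by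
  choose! d hd hdL using hD
  intro N P hN hP
  set g : ℤ → ℕ → ℂ := fun s k => L μ P s k with hg
  have hg0 : ∀ s : ℤ, 1 ≤ s → s ≤ N → ∀ l ≤ M, g s l = 0 := by
    intro s h1 hs l hl
    lift s to ℕ using by omega
    exact hP.2 s l (by omega) (by omega) hl
  have hfc : ∀ (Q : Bi) (t : ℕ), t ≤ M → ∀ r : ℤ, fc μ (fun x => ev Q x * conj (ev (d t) x)) (r - n) 0 =
      ∑ l ∈ Finset.range (M + 1), ∑ i ∈ Finset.range (2 * n + 1),
        conj (((d t).coeff l).coeff i) * L μ Q (r - n + i) l := by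
    intro Q t ht r
    rw [fc_ev_mul_conj_ev Q (hd t ht)]
    simp only [zero_add]
  have hcoef : ∀ t ≤ M, ∀ r : ℕ, ∑ l ∈ Finset.range (M + 1), ∑ i ∈ Finset.range (2 * n + 1),
      conj (((d t).coeff l).coeff i) * g (r - n + i) l = (P.coeff t).coeff r := by
    intro t ht r
    rw [← hfc P t ht]
    have h1 := fc_mul_conj_dual hP.1 (hdL t ht) (k := 0) (by omega) (n - r : ℤ) r (by ring)
    rw [if_pos (Nat.zero_le _), Nat.sub_zero, Nat.cast_zero] at h1
    have h2 := fc_conj (μ := μ) (F := fun x => ev (d t) x * conj (ev P x)) (r - n : ℤ) 0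
    rw [neg_sub, neg_zero, h1, Complex.conj_conj] at h2
    rw [← h2]
    simp only [map_mul, Complex.conj_conj, mul_comm]
  have hmain := tail_eq_zero hd hdL hg0
    (fun t ht s hs => by rw [hcoef t ht s, hP.1 t s (Or.inr hs)]) (hlim P) hN
  have hall : ∀ s : ℤ, 1 ≤ s → ∀ l ≤ M, g s l = 0 := by
    intro s hs l hl
    rcases le_or_gt s N with h | h
    · exact hg0 s hs h l hl
    · lift s to ℕ using by omega
      exact hmain s (by omega) l hl
  refine ⟨fun k i hki => ?_, fun s k h1 hk => hall s (by omega) k hk⟩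
  rcases Nat.lt_or_ge M k with hk | hk
  · exact hP.1 k i (Or.inl hk)
  · rw [← hcoef k hk i]
    refine Finset.sum_eq_zero fun l hl => Finset.sum_eq_zero fun j _ => ?_
    rw [hall _ (by omega) l (by simp at hl; omega), mul_zero]

end BernsteinSzego

/-! ### Stability for Bernstein–Szegő measures. -/

namespace BernsteinSzego

open Polynomial ComplexConjugate Filter Topology

/-- The Riemann–Lebesgue lemma for continuous functions on the torus. -/
theorem tendsto_fc_sigma {Φ : Torus → ℂ} (hΦ : Continuous Φ) (k : ℤ) :
    Tendsto (fun s : ℕ => fc sigma Φ s k) atTop (𝓝 0) := by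
  have htrig : ∀ f ∈ Submodule.span ℂ (Set.range chiB),
      ∀ᶠ s : ℕ in atTop, fc sigma f s k = 0 := by
    intro f hf
    induction hf using Submodule.span_induction with
    | mem x hx =>
      obtain ⟨u, rfl⟩ := hx
      filter_upwards [eventually_gt_atTop u.1.toNat] with s hs
      have h := fc_mul_chi (μ := sigma) (F := fun _ => 1) u.1 u.2 s k
      rw [fc_one_sigma, if_neg (by omega)] at h
      simpa [fc, chiB_apply] using h
    | zero => simp [fc]
    | add a b _ _ ha hb =>
      filter_upwards [ha, hb] with s h1 h2
      have := fc_add (μ := sigma) a.continuous b.continuous s k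
      rw [h1, h2, add_zero] at this
      exact this
    | smul c a _ ha =>
      filter_upwards [ha] with s h1
      have := fc_const_mul (μ := sigma) (F := a) c s k
      rw [h1, mul_zero] at this
      exact this
  rw [Metric.tendsto_nhds]
  intro ε hε
  have hmem : (⟨Φ, hΦ⟩ : C(Torus, ℂ)) ∈
      (trigPoly.map (BoundedContinuousFunction.toContinuousMapStarₐ ℂ)).topologicalClosure := by
    rw [ContinuousMap.starSubalgebra_topologicalClosure_eq_top_of_separatesPoints _
      trigPoly_separatesPoints]
    trivial
  obtain ⟨_, ⟨f, hf, rfl⟩, hdist⟩ := Metric.mem_closure_iff.1 hmem ε hε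
  filter_upwards [htrig f hf] with s hs
  rw [dist_zero_right]
  have hcf : Continuous f := f.continuous
  have h1 : fc sigma Φ s k = fc sigma (fun x => Φ x - f x) s k := by
    rw [fc_sub hΦ hcf, hs, sub_zero]
  have h2 : ‖fc sigma (fun x => Φ x - f x) s k‖ ≤ dist (⟨Φ, hΦ⟩ : C(Torus, ℂ)) f.toContinuousMap := by
    rw [fc]
    refine (norm_integral_le_of_norm_le_const (C := dist (⟨Φ, hΦ⟩ : C(Torus, ℂ)) f.toContinuousMap)
      (Eventually.of_forall fun x => ?_)).trans_eq ?_
    · rw [norm_mul, norm_chi, mul_one, ← dist_eq_norm]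
      exact ContinuousMap.dist_apply_le_dist (f := (⟨Φ, hΦ⟩ : C(Torus, ℂ))) x
    · simp
  rw [h1]
  exact h2.trans_lt hdist

/-- The polynomial `p` has no zeros on `𝕋 × 𝔻̄`. -/
def ZeroFree (p : Bi) : Prop := ∀ z w : ℂ, ‖z‖ = 1 → ‖w‖ ≤ 1 → p.evalEval z w ≠ 0

variable {p : Bi}

theorem ZeroFree.ev_ne_zero (hp : ZeroFree p) (x : Torus) : ev p x ≠ 0 :=
  hp _ _ (Circle.norm_coe _) (Circle.norm_coe _).le

theorem ZeroFree.continuous_div (hp : ZeroFree p) (P : Bi) :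
    Continuous fun x => ev P x / ev p x :=
  (continuous_ev P).div (continuous_ev p) hp.ev_ne_zero

/-- Mean value property in `w`. The factor `0 ^ j` covers both uses: it is 1 for `j = 0` and 0
otherwise. -/
theorem ZeroFree.fc_div (hp : ZeroFree p) (P : Bi) (s : ℤ) (j : ℕ) :
    fc sigma (fun x => ev P x / ev p x) s (-j) =
      ∫ z : Circle, P.evalEval (z : ℂ) 0 / p.evalEval (z : ℂ) 0 * (z : ℂ) ^ (-s) * 0 ^ j
        ∂arcLength := by
  have h := integral_sigma_of_diffContOnCl
    (fun z w => P.evalEval z w / p.evalEval z w * z ^ (-s) * w ^ j) ?_ ?_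
  · rw [← h, fc]
    refine integral_congr_ae (Eventually.of_forall fun x => ?_)
    simp only [chi, ev, neg_neg, zpow_natCast]
    ring
  · have h2 := (hp.continuous_div P).mul (continuous_chi (-s) j)
    refine h2.congr fun x => ?_
    simp only [Pi.mul_apply, chi, ev, zpow_natCast]
    ring
  · intro z hz
    refine DifferentiableOn.diffContOnCl ?_
    rw [closure_ball _ one_ne_zero]
    have hd : ∀ Q : Bi, Differentiable ℂ fun w => Q.evalEval z w := by
      intro Q
      simp only [← map_evalRingHom_eval]
      exact Polynomial.differentiable _
    exact (((hd P).differentiableOn.div (hd p).differentiableOn fun w hw =>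
      hp z w hz (mem_closedBall_zero_iff.1 hw)).mul_const _).mul
        (differentiable_pow j).differentiableOn

theorem ZeroFree.fc_div_of_neg (hp : ZeroFree p) (P : Bi) (s : ℤ) {k : ℤ} (hk : k < 0) :
    fc sigma (fun x => ev P x / ev p x) s k = 0 := by
  obtain ⟨j, rfl⟩ := Int.exists_eq_neg_ofNat hk.le
  rw [hp.fc_div, zero_pow (by omega)]
  simp

theorem ZeroFree.fc_div_zero (hp : ZeroFree p) (s : ℤ) :
    fc sigma (fun x => ev (C (p.coeff 0)) x / ev p x) s 0 = if s = 0 then 1 else 0 := by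
  have h := hp.fc_div (C (p.coeff 0)) s 0
  rw [Nat.cast_zero, neg_zero] at h
  rw [h]
  have h2 : ∀ z : ℂ, p.evalEval z 0 = (C (p.coeff 0)).evalEval z 0 := fun z => by
    rw [evalEval_C, evalEval, coeff_zero_eq_eval_zero, C_0]
  have h3 : ∀ z : Circle, (C (p.coeff 0)).evalEval (z : ℂ) 0 / p.evalEval (z : ℂ) 0 *
      (z : ℂ) ^ (-s) * 0 ^ 0 = (z : ℂ) ^ (-s) := fun z => by
    have := hp z 0 (Circle.norm_coe z) (by simp)
    rw [← h2, div_self this, one_mul, pow_zero, mul_one]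
  simp only [h3, integral_arcLength_zpow, neg_eq_zero]

theorem ZeroFree.continuous_density (hp : ZeroFree p) :
    Continuous fun x => 1 / ‖ev p x‖ ^ 2 :=
  continuous_const.div (by fun_prop) fun x => pow_ne_zero 2 (norm_ne_zero_iff.2 (hp.ev_ne_zero x))

variable {μ : Measure Torus} {n m M : ℕ}

theorem ZeroFree.L_eq (hp : ZeroFree p)
    (hμ : μ = sigma.withDensity fun x => ENNReal.ofReal (1 / ‖ev p x‖ ^ 2)) (P : Bi) (s k : ℤ) :
    L μ P s k = fc sigma (fun x => ev P x / (ev p x * conj (ev p x))) s k := by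
  rw [L, hμ, fc_withDensity_ofReal hp.continuous_density.measurable fun x => by positivity]
  congr 1
  funext x
  rw [Complex.mul_conj']
  push_cast
  ring

theorem ZeroFree.tendsto_L (hp : ZeroFree p)
    (hμ : μ = sigma.withDensity fun x => ENNReal.ofReal (1 / ‖ev p x‖ ^ 2)) (P : Bi) (k : ℕ) :
    Tendsto (fun s : ℕ => L μ P s k) atTop (𝓝 0) := by
  simp only [hp.L_eq hμ]
  exact tendsto_fc_sigma ((continuous_ev P).div (by fun_prop) fun x =>
    mul_ne_zero (hp.ev_ne_zero x) ((_root_.map_ne_zero _).2 (hp.ev_ne_zero x))) k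

theorem eq_zero_of_ev_ae_eq_zero {P : Bi} (h : ∀ᵐ x ∂sigma, ev P x = 0) : P = 0 := by
  obtain ⟨N, M, hP⟩ := exists_deg P
  ext l i
  rw [coeff_zero, coeff_zero]
  by_cases hli : M < l ∨ N < i
  · exact hP l i hli
  have h0 : L sigma P i l = 0 := by
    rw [L, fc]
    exact integral_eq_zero_of_ae (h.mono fun x hx => by simp [hx])
  rw [hP.L_eq, Finset.sum_eq_single l, Finset.sum_eq_single i] at h0
  · simpa [fc_one_sigma] using h0
  · intro i' _ hi'
    rw [fc_one_sigma, if_neg (by omega), mul_zero]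
  · simp; omega
  · intro l' _ hl'
    refine Finset.sum_eq_zero fun i' _ => ?_
    rw [fc_one_sigma, if_neg (by omega), mul_zero]
  · simp; omega

theorem ZeroFree.nonDegenerate (hp : ZeroFree p)
    (hμ : μ = sigma.withDensity fun x => ENNReal.ofReal (1 / ‖ev p x‖ ^ 2)) : NonDegenerate μ := by
  rw [nonDegenerate_iff]
  intro P hP
  have hc := hp.continuous_density
  rw [hμ, integral_withDensity_eq_integral_toReal_smul hc.measurable.ennreal_ofReal
    (Eventually.of_forall fun x => ENNReal.ofReal_lt_top)] at hP
  have h0 : ∀ x : Torus, (ENNReal.ofReal (1 / ‖ev p x‖ ^ 2)).toReal = 1 / ‖ev p x‖ ^ 2 :=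
    fun x => ENNReal.toReal_ofReal (by positivity)
  simp only [h0, smul_eq_mul] at hP
  rw [integral_eq_zero_iff_of_nonneg (fun x => by positivity)
    (integrable_torus (by fun_prop) _)] at hP
  refine eq_zero_of_ev_ae_eq_zero (hP.mono fun x hx => ?_)
  have := hp.ev_ne_zero x
  simpa [this] using hx

/-- The generator of every `H_M` is `z^n conj(p(z,0)) p`: divided by `|p|²` it becomes `z^n
conj(p(z,0)/p)`, and `p(z,0)/p` is analytic in `w` with value 1 at `w = 0`. -/
theorem ZeroFree.hStable [IsFiniteMeasure μ] (hp : ZeroFree p) (hdeg : Deg n m p)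
    (hμ : μ = sigma.withDensity fun x => ENNReal.ofReal (1 / ‖ev p x‖ ^ 2)) : HStable μ n m := by
  have hq := hdeg.natDegree_coeff_le 0
  have hL : ∀ s k : ℕ, L μ (C (rev n (p.coeff 0)) * p) s k = if s = n ∧ k = 0 then 1 else 0 := by
    intro s k
    rw [hp.L_eq hμ]
    have h1 : (fun x => ev (C (rev n (p.coeff 0)) * p) x / (ev p x * conj (ev p x))) =
        fun x => conj (ev (C (p.coeff 0)) x / ev p x) * chi n 0 x := by
      funext x
      have h0 := hp.ev_ne_zero x
      have h0' := (_root_.map_ne_zero (starRingEnd ℂ)).2 h0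
      rw [ev_mul, ev_C, ev_C, eval_rev hq (Circle.norm_coe _), map_div₀]
      simp only [chi, zpow_natCast, zpow_zero, mul_one]
      field_simp
    rw [h1, fc_mul_chi, fc_conj]
    rcases Nat.eq_zero_or_pos k with rfl | hk
    · simp only [Nat.cast_zero, sub_zero, neg_zero, hp.fc_div_zero, apply_ite conj, map_one,
        map_zero, and_true]
      exact if_congr (by omega) rfl rfl
    · rw [hp.fc_div_of_neg _ _ (by omega), map_zero, if_neg (by omega)]
  have hmem : ∀ M, m ≤ M → MemH μ n M (C (rev n (p.coeff 0)) * p) := fun M hM =>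
    ⟨(hdeg.C_mul (natDegree_rev_le hq)).mono (by omega) hM, fun s k _ _ hsk => by
      rw [hL, if_neg (by simpa using hsk)]⟩
  have h1 : L μ (C (rev n (p.coeff 0)) * p) n 0 = 1 := by simpa using hL n 0
  have hnd := hp.nonDegenerate hμ
  refine fun M P hM => ⟨fun h => ?_, fun h => ?_⟩
  · rw [hnd.memH_eq_smul h (hmem m le_rfl) h1]
    exact (hmem M hM).smul _
  · rw [hnd.memH_eq_smul h (hmem M hM) h1]
    exact (hmem m le_rfl).smul _

theorem Deg.exists_split {N a b : ℕ} {P : Bi} (hP : Deg N (a + b + 1) P) :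
    ∃ Q R, Deg N a Q ∧ Deg N b R ∧ P = Q + X ^ (a + 1) * R := by
  refine ⟨ofCoeff N a fun i k => (P.coeff k).coeff i,
    ofCoeff N b fun i k => (P.coeff (a + 1 + k)).coeff i, deg_ofCoeff _ _ _, deg_ofCoeff _ _ _, ?_⟩
  ext k i
  rw [coeff_add, coeff_add, coeff_ofCoeff, coeff_X_pow_mul']
  by_cases hk : a + 1 ≤ k
  · rw [if_pos hk, coeff_ofCoeff, if_neg (by omega), zero_add, Nat.add_sub_cancel' hk]
    split_ifs with h
    · rfl
    · exact hP k i (by omega)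
  · rw [if_neg hk, coeff_zero, add_zero]
    split_ifs with h
    · rfl
    · exact hP k i (by omega)

theorem ZeroFree.hasDual [IsFiniteMeasure μ] (hp : ZeroFree p) (hdeg : Deg n m p)
    (hμ : μ = sigma.withDensity fun x => ENNReal.ofReal (1 / ‖ev p x‖ ^ 2)) (hM : m ≤ M + 1) :
    HasDual μ n M := by
  intro b hb
  obtain ⟨c, rfl⟩ := Nat.exists_eq_add_of_le hb
  -- With `M = b + c`, the polynomial `p` is cut after `w^b` and after `w^c`; this requires only `m
  -- ≤ M + 1`.
  obtain ⟨Q, R, hQ, hR, hp1⟩ := (hdeg.mono le_rfl hM).exists_split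
  rw [add_comm b c] at hM
  obtain ⟨Q', R', hQ', hR', hp2⟩ := (hdeg.mono le_rfl hM).exists_split
  refine ⟨revBi n b Q * Q' - R' * revBi n c R, Deg.sub ?_ ?_, fun s k hk => ?_⟩
  · exact ((deg_revBi n b Q).mul hQ').mono (by omega) le_rfl
  · exact (hR'.mul (deg_revBi n c R)).mono (by omega) le_rfl
  rw [hp.L_eq hμ]
  -- A Christoffel–Darboux type identity: besides `z^n w^b` there remain a term with powers of `w`
  -- above `M` only and one with negative powers only. Neither meets `0 ≤ k ≤ M`.
  have h1 : (fun x => ev (revBi n b Q * Q' - R' * revBi n c R) x / (ev p x * conj (ev p x))) =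
      fun x => 1 * chi n b x - ev R' x / ev p x * chi n (b + c + 1) x -
        conj (ev R x / ev p x) * chi n (-1) x := by
    funext x
    have h0 := hp.ev_ne_zero x
    have h0' := (_root_.map_ne_zero (starRingEnd ℂ)).2 h0
    have e1 : ev Q x = ev p x - chi 0 (b + 1) x * ev R x := by
      conv_rhs => rw [hp1]
      simp [chi]
      norm_cast
      ring
    have e2 : ev Q' x = ev p x - chi 0 (c + 1) x * ev R' x := by
      conv_rhs => rw [hp2]
      simp [chi]
      norm_cast
      ring
    have e3 : chi n b x * chi 0 (c + 1) x = chi n (b + c + 1) x := by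
      rw [chi_mul_chi]; ring_nf
    have e4 : chi n b x * chi 0 (-(b + 1)) x = chi n (-1) x := by
      rw [chi_mul_chi]; ring_nf
    have e5 : chi n (-1) x * chi 0 (c + 1) x = chi n c x := by
      rw [chi_mul_chi]; ring_nf
    rw [ev_sub, ev_mul, ev_mul, ev_revBi hQ, ev_revBi hR, e1, e2, map_sub, map_mul, conj_chi,
      neg_zero, map_div₀]
    rw [div_eq_iff (mul_ne_zero h0 h0')]
    have f1 : ev R' x / ev p x * ev p x = ev R' x := div_mul_cancel₀ _ h0
    have f2 : conj (ev R x) / conj (ev p x) * conj (ev p x) = conj (ev R x) :=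
      div_mul_cancel₀ _ h0'
    rw [← e5, ← e3, ← e4]
    linear_combination (chi n b x * chi 0 (c + 1) x * conj (ev p x)) * f1 +
      chi n b x * chi 0 (-(b + 1)) x * ev p x * f2
  have hcR := hp.continuous_div R
  have hcR' := hp.continuous_div R'
  rw [h1, fc_sub (by fun_prop) (by fun_prop), fc_sub (by fun_prop) (by fun_prop), fc_mul_chi,
    fc_mul_chi, fc_mul_chi, fc_conj, hp.fc_div_of_neg _ _ (by omega),
    hp.fc_div_of_neg _ _ (by omega), map_zero, sub_zero, sub_zero, fc_one_sigma]
  exact if_congr (by omega) rfl rfl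

/-- The measure `dσ / |p|²` has all the stability properties. -/
theorem IsBernsteinSzego.stable [IsFiniteMeasure μ] (h : IsBernsteinSzego μ n m) :
    NonDegenerate μ ∧ (∀ M, m ≤ M + 1 → EStable μ n M) ∧ HStable μ n m := by
  obtain ⟨p, hdeg, hp, hμ⟩ := (isBernsteinSzego_iff μ n m).1 h
  replace hp : ZeroFree p := hp
  exact ⟨hp.nonDegenerate hμ, fun M hM => (hp.hasDual hdeg hμ hM).eStable (hp.tendsto_L hμ),
    hp.hStable hdeg hμ⟩

end BernsteinSzego

end

/-! ### The two characterizations. -/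

theorem mainTheorem8 (μ : MeasureTheory.Measure BernsteinSzego.Torus)
    [MeasureTheory.IsFiniteMeasure μ] (n m : ℕ) :
    (BernsteinSzego.NonDegenerate μ →
      (BernsteinSzego.IsBernsteinSzego μ n m ↔
        (∀ (M : ℤ) (j : ℕ), (m : ℤ) - 1 ≤ M →
          BernsteinSzego.spaceE μ n M = BernsteinSzego.spaceE μ (n + j) M) ∧
        (∀ j : ℕ, BernsteinSzego.spaceH μ n m = BernsteinSzego.spaceH μ n (m + j)))) ∧
    (BernsteinSzego.IsBernsteinSzego μ n m ↔
      (∀ N M : ℕ, (BernsteinSzego.momentMatrix μ N M).det ≠ 0) ∧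
      (∀ N M : ℕ, n ≤ N → (m : ℤ) - 1 ≤ (M : ℤ) → ∀ j k : Fin (M + 1),
        (BernsteinSzego.momentMatrix μ (N + 1) M)⁻¹ (0, j) (Fin.last (N + 1), k) = 0) ∧
      (∀ M : ℕ, m < M → ∀ j : Fin (2 * n + 1),
        (BernsteinSzego.momentMatrix μ (2 * n) M)⁻¹
          (⟨n, by omega⟩, 0) (j, Fin.last M) = 0)) := by
  open BernsteinSzego in
  refine ⟨fun hμ => ?_, fun h => ?_, fun ⟨h1, h2, h3⟩ => ?_⟩
  · rw [eStable_int_iff, ← hStable_iff]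
    exact ⟨fun h => h.stable.2, fun h => isBernsteinSzego_of_stable hμ h.1 h.2⟩
  · obtain ⟨hμ, hE, hH⟩ := h.stable
    exact ⟨det_ne_zero_iff.2 hμ,
      fun N M hN hM => (hμ.eStable_iff_inv n M).1 (hE M (by omega)) N hN,
      (hμ.hStable_iff_inv n m _).1 hH⟩
  · have hμ := det_ne_zero_iff.1 h1
    exact isBernsteinSzego_of_stable hμ
      (fun M hM => (hμ.eStable_iff_inv n M).2 fun N hN => h2 N M hN (by omega))
      ((hμ.hStable_iff_inv n m _).2 h3)
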